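/- **Conventions.** For possibly undefined expressions, $e'\preceq e$ means: if $e$ is defined, then $e'$ is defined and $e'\le e$. A *partial applicative poset* (PAP) is a poset $A$ with a partial binary application $(a,b)\mapsto ab$ (associating to the left) such that $a'\le a$, $b'\le b$ imply $a'b'\preceq ab$. A *filter* of $A$ is a non-empty, upwards closed subset that is closed under (defined) application. A (relative, ordered) *PCA* is a PAP $A$ with a filter $A^\#$ for which there are $\mathsf k,\mathsf s\in A^\#$ such that $\mathsf kab\le a$ (in particular it is defined), $\mathsf sab$ is defined, and $\mathsf sabc\preceq ac(bc)$ for all $a,b,c\in A$. Let $A$ be a PCA with chosen $\mathsf k,\mathsf s$. Bracket abstraction is defined by $\lambda^*x.x=\mathsf i:=\mathsf{skk}$, $\lambda^*x.t=\mathsf kt$ for $t$ a constant or a variable other than $x$, and $\lambda^*x.t_0t_1=\mathsf s(\lambda^*x.t_0)(\lambda^*x.t_1)$. Put $\top=\mathsf k$, $\bot=\mathsf{ki}$, $\mathsf p=\lambda^*xyz.zxy$, $\mathsf p_0=\lambda^*x.x\top$, $\mathsf p_1=\lambda^*x.x\bot$; numerals $\overline 0=\mathsf i$, $\overline{n+1}=\mathsf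 p\bot\overline n$; tuples $j^0()=\mathsf i$, $j^{n+1}(a_0,\dots,a_n)=\mathsf pa_0\,(j^n(a_1,\dots,a_n))$; and sequence codes $[a_0,\dots,a_{n-1}]=\mathsf p\,\overline n\,(j^n(a_0,\dots,a_{n-1}))$. Assume that $A$ is *not semitrivial*, i.e. $\top$ and $\bot$ have no common lower bound in $A$. **The structure $\mathcal BA$.** Let $\mathcal BA$ be the set of partial functions $\alpha\colon A\rightharpoonup A$ such that $a\le b$ implies $\alpha(a)\preceq\alpha(b)$, ordered by $\alpha\le\beta$ iff $\alpha(a)\preceq\beta(a)$ for all $a\in A$. Its (total) application is given by: $\alpha\beta(a)=c$ iff there is a finite, possibly empty, sequence $u_0,\dots,u_{n-1}\in A$ such that - for all $i<n$: $\mathsf p_0\cdot\alpha([a,u_0,\dots,u_{i-1}])\le\bot$ and $\beta(\mathsf p_1\cdot\alpha([a,u_0,\dots,u_{i-1}]))=u_i$; - $\mathsf p_0\cdot\alpha([a,u_0,\dots,u_{n-1}])\le\top$ and $\mathsf p_1\cdot\alpha([a,u_0,\dots,u_{n-1}])=c$. Let $(\mathcal BA)^\#$ be the set of effectively representable functions,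 i.e. of those $\alpha\in\mathcal BA$ for which there is an $r\in A^\#$ with $ra\preceq\alpha(a)$ for all $a\in A$. **Morphisms.** For a PCA $B$ let $DB$ be the set of downwards closed subsets of $B$. For $\alpha,\beta\in DB$, the application $\alpha\cdot\beta$ is defined iff $ab$ is defined for all $a\in\alpha$, $b\in\beta$, and is then the downset generated by all these $ab$; for $b\in B$, $b\cdot\alpha$ means ${\downarrow}\{b\}\cdot\alpha$. A *partial applicative morphism* from a PCA $A$ to a PCA $B$ is a function $f\colon A\to DB$ such that 1. $f(a)\cap B^\#\ne\emptyset$ for all $a\in A^\#$; 2. there is a $t\in B^\#$ such that, whenever $aa'$ is defined, $t\cdot f(a)\cdot f(a')$ is defined and contained in $f(aa')$; 3. there is a $u\in B^\#$ such that $u\cdot f(a)$ is defined for all $a\in A$, and $u\cdot f(a)\subseteq f(a')$ whenever $a\le a'$. It is *total* if $f(a)\neq\emptyset$ for all $a\in A$, and *computationally dense* if there is an $n\in B^\#$ such that for every $s\in B^\#$ there is an $r\in A^\#$ for which $n\cdot f(r)$ is defined and contained in ${\downarrow}\{s\}$. **Proposition.** Let $A$ be a PCA that is not semitrivial. Then $\mathcal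 BA$, with the order, application and filter $(\mathcal BA)^\#$ described above, is a PCA, and the map $i\colon A\to D(\mathcal BA)$ given by $i(a)={\downarrow}\{\hat a\}$, where $\hat a\in\mathcal BA$ is the constant function with value $a$, is a partial applicative morphism from $A$ to $\mathcal BA$ that is total and computationally dense. -/

import Mathlib

namespace ROPCA

/-! ### Possibly undefined expressions -/

/-- `Prec e' e` is the relation `e' ≼ e`: if `e` is defined, then so is `e'`, and `e' ≤ e`. -/
def Prec {A : Type*} [PartialOrder A] (e' e : Part A) : Prop :=
  ∀ a ∈ e, ∃ a' ∈ e', a' ≤ a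

theorem Prec.refl {A : Type*} [PartialOrder A] (e : Part A) : Prec e e :=
  fun a ha => ⟨a, ha, le_rfl⟩

theorem Prec.trans {A : Type*} [PartialOrder A] {e₁ e₂ e₃ : Part A}
    (h : Prec e₁ e₂) (h' : Prec e₂ e₃) : Prec e₁ e₃ := by
  intro a ha
  obtain ⟨b, hb, hba⟩ := h' a ha
  obtain ⟨c, hc, hcb⟩ := h b hb
  exact ⟨c, hc, hcb.trans hba⟩

theorem Prec.antisymm {A : Type*} [PartialOrder A] {e e' : Part A}
    (h : Prec e e') (h' : Prec e' e) : e = e' := by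
  have key : ∀ {e e' : Part A}, Prec e e' → Prec e' e → ∀ a ∈ e, a ∈ e' := by
    intro e e' h h' a ha
    obtain ⟨b, hb, hba⟩ := h' a ha
    obtain ⟨c, hc, hcb⟩ := h b hb
    have hca : c = a := Part.mem_unique hc ha
    have hab : b = a := le_antisymm hba (hca ▸ hcb)
    exact hab ▸ hb
  exact Part.ext fun a => ⟨key h h' a, key h' h a⟩

theorem Prec.dom {A : Type*} [PartialOrder A] {e e' : Part A}
    (h : Prec e' e) (he : e.Dom) : e'.Dom := by
  obtain ⟨b, hb, -⟩ := h _ (Part.get_mem he)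
  exact Part.dom_iff_mem.2 ⟨b, hb⟩

/-! ### Partial applicative posets, filters, PCAs -/

/-- A partial applicative poset (PAP) on the poset `A`. -/
structure PAP (A : Type*) [PartialOrder A] where
  /-- The partial application map. -/
  app : A → A → Part A
  app_mono : ∀ a' a b' b : A, a' ≤ a → b' ≤ b → Prec (app a' b') (app a b)

/-- Application of possibly undefined expressions. -/
def PAP.ap {A : Type*} [PartialOrder A] (P : PAP A) (x y : Part A) : Part A :=
  x.bind fun a => y.bind fun b => P.app a b

theorem PAP.ap_mono {A : Type*} [PartialOrder A] (P : PAP A) {x' x y' y : Part A}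
    (hx : Prec x' x) (hy : Prec y' y) : Prec (P.ap x' y') (P.ap x y) := by
  intro c hc
  simp only [PAP.ap, Part.mem_bind_iff] at hc ⊢
  obtain ⟨a, ha, b, hb, hc⟩ := hc
  obtain ⟨a', ha', haa⟩ := hx a ha
  obtain ⟨b', hb', hbb⟩ := hy b hb
  obtain ⟨c', hc', hcc⟩ := P.app_mono _ _ _ _ haa hbb c hc
  exact ⟨c', ⟨a', ha', b', hb', hc'⟩, hcc⟩

/-- A filter of a PAP. -/
structure PAP.IsFilter {A : Type*} [PartialOrder A] (P : PAP A) (F : Set A) : Prop where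
  nonempty : F.Nonempty
  app_closed : ∀ a ∈ F, ∀ b ∈ F, ∀ c ∈ P.app a b, c ∈ F
  up_closed : ∀ a b : A, a ≤ b → a ∈ F → b ∈ F

/-- `k` and `s` satisfy the combinator axioms `kab ≤ a`, `sab↓` and `sabc ≼ ac(bc)`. -/
structure PAP.IsCombinatorPair {A : Type*} [PartialOrder A] (P : PAP A) (k s : A) : Prop where
  k_le : ∀ a b : A, ∃ c ∈ P.ap (P.app k a) (Part.some b), c ≤ a
  s_dom : ∀ a b : A, (P.ap (P.app s a) (Part.some b)).Dom
  s_prec : ∀ a b c : A,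
    Prec (P.ap (P.ap (P.app s a) (Part.some b)) (Part.some c)) (P.ap (P.app a c) (P.app b c))

/-- A PAP together with a distinguished subset `A^#`. -/
structure RelPAP (A : Type*) [PartialOrder A] extends PAP A where
  /-- The distinguished subset `A^#` of effective elements. -/
  sharp : Set A

/-- `(A, A^#, ·, ≤)` is a partial applicative structure: `A^#` is a filter. -/
def RelPAP.IsPAS {A : Type*} [PartialOrder A] (P : RelPAP A) : Prop :=
  P.toPAP.IsFilter P.sharp

/-- `(A, A^#, ·, ≤)` is a (relative, ordered) PCA. -/
def RelPAP.IsPCA {A : Type*} [PartialOrder A] (P : RelPAP A) : Prop :=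
  P.IsPAS ∧ ∃ k ∈ P.sharp, ∃ s ∈ P.sharp, P.toPAP.IsCombinatorPair k s

/-- A (relative, ordered) PCA, with an explicit choice of the combinators `k` and `s`. -/
structure PCA (A : Type*) [PartialOrder A] extends RelPAP A where
  isPAS : toRelPAP.IsPAS
  /-- The chosen combinator `k`. -/
  k : A
  /-- The chosen combinator `s`. -/
  s : A
  k_mem : k ∈ sharp
  s_mem : s ∈ sharp
  comb : toPAP.IsCombinatorPair k s

theorem PCA.isPCA {A : Type*} [PartialOrder A] (P : PCA A) : P.toRelPAP.IsPCA :=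
  ⟨P.isPAS, P.k, P.k_mem, P.s, P.s_mem, P.comb⟩

/-! ### Terms and bracket abstraction -/

/-- Terms over `A`, with variables indexed by `ℕ`. -/
inductive Term (A : Type*) where
  | var : ℕ → Term A
  | const : A → Term A
  | app : Term A → Term A → Term A

/-- The possibly undefined value of a term under an assignment of the variables. -/
def PAP.eval {A : Type*} [PartialOrder A] (P : PAP A) (ρ : ℕ → A) : Term A → Part A
  | .var n => Part.some (ρ n)
  | .const a => Part.some a
  | .app t₀ t₁ => P.ap (P.eval ρ t₀) (P.eval ρ t₁)

namespace PCA

variable {A : Type*} [PartialOrder A] (P : PCA A)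

theorem ka_dom (a : A) : (P.app P.k a).Dom := by
  obtain ⟨c, hc, -⟩ := P.comb.k_le a a
  simp only [PAP.ap, Part.mem_bind_iff] at hc
  obtain ⟨d, hd, -⟩ := hc
  exact Part.dom_iff_mem.2 ⟨d, hd⟩

theorem skk_dom : (P.ap (P.app P.s P.k) (Part.some P.k)).Dom :=
  P.comb.s_dom P.k P.k

/-- The identity combinator `i = skk`. -/
def i : A := (P.ap (P.app P.s P.k) (Part.some P.k)).get P.skk_dom

/-- The boolean `⊤ = k`. -/
def tt : A := P.k

/-- The boolean `⊥ = ki`. -/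
def ff : A := (P.app P.k P.i).get (P.ka_dom P.i)

/-- `A` is semitrivial if `⊤` and `⊥` have a common lower bound. -/
def Semitrivial : Prop := ∃ u : A, u ≤ P.tt ∧ u ≤ P.ff

/-- The term `λ* x. t`. -/
def lam (x : ℕ) : Term A → Term A
  | .var y => if y = x then .const P.i else .app (.const P.k) (.var y)
  | .const a => .app (.const P.k) (.const a)
  | .app t₀ t₁ => .app (.app (.const P.s) (lam x t₀)) (lam x t₁)

theorem i_app (a : A) : ∃ c ∈ P.app P.i a, c ≤ a := by
  have h := P.comb.s_prec P.k P.k a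
  obtain ⟨c, hc, hca⟩ := P.comb.k_le a ((P.app P.k a).get (P.ka_dom a))
  have h2 : c ∈ P.ap (P.app P.k a) (P.app P.k a) := by
    rwa [Part.some_get] at hc
  obtain ⟨d, hd, hdc⟩ := h c h2
  refine ⟨d, ?_, hdc.trans hca⟩
  have hi : P.ap (P.app P.s P.k) (Part.some P.k) = Part.some P.i :=
    (Part.some_get P.skk_dom).symm
  rw [hi] at hd
  simpa [PAP.ap] using hd

theorem lam_dom (ρ : ℕ → A) (x : ℕ) (t : Term A) : (P.eval ρ (P.lam x t)).Dom := by
  induction t with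
  | var y =>
    by_cases h : y = x
    · simp [lam, h, PAP.eval]
    · simpa [lam, h, PAP.eval, PAP.ap] using P.ka_dom (ρ y)
  | const a => simpa [lam, PAP.eval, PAP.ap] using P.ka_dom a
  | app t₀ t₁ h₀ h₁ =>
    obtain ⟨b₀, hb₀⟩ := Part.dom_iff_mem.1 h₀
    obtain ⟨b₁, hb₁⟩ := Part.dom_iff_mem.1 h₁
    have := P.comb.s_dom b₀ b₁
    simp only [lam, PAP.eval]
    rw [Part.eq_some_iff.2 hb₀, Part.eq_some_iff.2 hb₁]
    simpa [PAP.ap] using this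

theorem lam_app (ρ : ℕ → A) (x : ℕ) (t : Term A) (a : A) :
    Prec (P.ap (P.eval ρ (P.lam x t)) (Part.some a)) (P.eval (Function.update ρ x a) t) := by
  induction t with
  | var y =>
    by_cases h : y = x
    · subst h
      intro b hb
      have hb' : b = a := by simpa [PAP.eval] using hb
      subst hb'
      simpa [lam, PAP.eval, PAP.ap] using P.i_app b
    · intro b hb
      have hb' : b = ρ y := by simpa [PAP.eval, h] using hb
      subst hb'
      simpa [lam, h, PAP.eval, PAP.ap] using P.comb.k_le (ρ y) a
  | const c =>
    intro b hb
    have hb' : b = c := by simpa [PAP.eval] using hb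
    subst hb'
    simpa [lam, PAP.eval, PAP.ap] using P.comb.k_le b a
  | app t₀ t₁ h₀ h₁ =>
    obtain ⟨b₀, hb₀⟩ := Part.dom_iff_mem.1 (P.lam_dom ρ x t₀)
    obtain ⟨b₁, hb₁⟩ := Part.dom_iff_mem.1 (P.lam_dom ρ x t₁)
    rw [Part.eq_some_iff.2 hb₀] at h₀
    rw [Part.eq_some_iff.2 hb₁] at h₁
    have h := (P.comb.s_prec b₀ b₁ a).trans
      (P.ap_mono (by simpa [PAP.ap] using h₀) (by simpa [PAP.ap] using h₁))
    simp only [lam, PAP.eval]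
    rw [Part.eq_some_iff.2 hb₀, Part.eq_some_iff.2 hb₁]
    simpa [PAP.ap] using h

/-- The element denoted by `λ* x. t`; the assignment of the variables is irrelevant when
`λ* x. t` is closed. -/
def lamVal (x : ℕ) (t : Term A) : A :=
  (P.eval (fun _ => P.k) (P.lam x t)).get (P.lam_dom _ x t)

/-- The pairing combinator `p = λ* x y z. z x y`. -/
def p : A :=
  P.lamVal 0 (P.lam 1 (P.lam 2 (.app (.app (.var 2) (.var 0)) (.var 1))))

/-- The unpairing combinator `p₀ = λ* x. x ⊤`, where `⊤ = k`. -/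
def p₀ : A := P.lamVal 0 (.app (.var 0) (.const P.tt))

/-- The unpairing combinator `p₁ = λ* x. x ⊥`, where `⊥ = ki`. -/
def p₁ : A := P.lamVal 0 (.app (.var 0) (.const P.ff))

theorem p_dom (a b : A) : (P.ap (P.app P.p a) (Part.some b)).Dom := by
  have h1 := P.lam_app (fun _ => P.k) 0
    (P.lam 1 (P.lam 2 (.app (.app (.var 2) (.var 0)) (.var 1)))) a
  have h2 := P.lam_app (Function.update (fun _ => P.k) 0 a) 1
    (P.lam 2 (.app (.app (.var 2) (.var 0)) (.var 1))) b
  have h3 := (P.ap_mono h1 (Prec.refl (Part.some b))).trans h2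
  have h4 := h3.dom (P.lam_dom _ _ _)
  have h5 : P.eval (fun _ => P.k)
      (P.lam 0 (P.lam 1 (P.lam 2 (.app (.app (.var 2) (.var 0)) (.var 1))))) = Part.some P.p :=
    (Part.some_get (P.lam_dom _ _ _)).symm
  rw [h5] at h4
  have h6 : P.ap (Part.some P.p) (Part.some a) = P.app P.p a := by simp [PAP.ap]
  rwa [h6] at h4

/-- The pair `p a b`. -/
def pair (a b : A) : A := (P.ap (P.app P.p a) (Part.some b)).get (P.p_dom a b)

theorem pair_mono {a' a b' b : A} (ha : a' ≤ a) (hb : b' ≤ b) : P.pair a' b' ≤ P.pair a b := by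
  have h : Prec (P.ap (P.app P.p a') (Part.some b')) (P.ap (P.app P.p a) (Part.some b)) := by
    refine P.ap_mono (P.app_mono _ _ _ _ le_rfl ha) ?_
    intro c hc
    exact ⟨b', Part.mem_some b', (Part.mem_some_iff.1 hc) ▸ hb⟩
  obtain ⟨c, hc, hle⟩ := h _ (Part.get_mem (P.p_dom a b))
  have : c = P.pair a' b' := Part.mem_unique hc (Part.get_mem (P.p_dom a' b'))
  exact this ▸ hle

/-- The numerals `0 = i` and `n + 1 = p ⊥ n`. -/
def num : ℕ → A
  | 0 => P.i
  | n + 1 => P.pair P.ff (num n)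

/-- The tupling functions `j⁰() = i` and `jⁿ⁺¹(a₀, …, aₙ) = p a₀ (jⁿ(a₁, …, aₙ))`. -/
def tuple : List A → A
  | [] => P.i
  | a :: l => P.pair a (tuple l)

/-- The code `[a₀, …, aₙ₋₁] = p n (jⁿ(a₀, …, aₙ₋₁))` of a finite sequence. -/
def code (l : List A) : A := P.pair (P.num l.length) (P.tuple l)

theorem code_mono {l' l : List A} (h : List.Forall₂ (· ≤ ·) l' l) : P.code l' ≤ P.code l := by
  have h2 : P.tuple l' ≤ P.tuple l := by
    induction h with
    | nil => exact le_rfl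
    | cons h₁ _ ih => exact P.pair_mono h₁ ih
  exact P.pair_mono (by rw [h.length_eq]) h2

end PCA

/-! ### The poset of partial functions -/

/-- The set `𝓑A` of partial functions `α` on `A` such that `a ≤ b` implies `α a ≼ α b`. -/
def BFun (A : Type*) [PartialOrder A] : Type _ :=
  {α : A → Part A // ∀ a b : A, a ≤ b → Prec (α a) (α b)}

/-- `α ≤ β` if `α a ≼ β a` for all `a`. -/
instance BFun.instPartialOrder {A : Type*} [PartialOrder A] : PartialOrder (BFun A) where
  le α β := ∀ a, Prec (α.1 a) (β.1 a)
  le_refl α a := Prec.refl _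
  le_trans _ _ _ h h' a := (h a).trans (h' a)
  le_antisymm _ _ h h' := Subtype.ext (funext fun a => (h a).antisymm (h' a))

/-- The total constant function `â` with value `a`. -/
def BFun.const {A : Type*} [PartialOrder A] (a : A) : BFun A :=
  ⟨fun _ => Part.some a, fun _ _ _ => Prec.refl _⟩

namespace PCA

variable {A : Type*} [PartialOrder A] (P : PCA A)

/-- The interrogator `α`, after receiving the sequence `l` (the input, followed by the answers
obtained so far), asks the oracle the question `q`: we have `p₀ · α([l]) ≤ ⊥` and
`p₁ · α([l]) = q`. -/
def Asks (α : BFun A) (l : List A) (q : A) : Prop :=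
  ∃ m ∈ α.1 (P.code l), (∃ t ∈ P.app P.p₀ m, t ≤ P.ff) ∧ q ∈ P.app P.p₁ m

/-- The interrogator `α`, after receiving the sequence `l`, returns the output `c`: we have
`p₀ · α([l]) ≤ ⊤` and `p₁ · α([l]) = c`. -/
def Returns (α : BFun A) (l : List A) (c : A) : Prop :=
  ∃ m ∈ α.1 (P.code l), (∃ t ∈ P.app P.p₀ m, t ≤ P.tt) ∧ c ∈ P.app P.p₁ m

/-- `u = (u₀, …, uₙ₋₁)` is a sequence of answers: for all `i < n`, the interrogator `α` asks a
question `q` after receiving `a, u₀, …, uᵢ₋₁`, and `β q = uᵢ`. -/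
def Answers (α β : BFun A) (a : A) (u : List A) : Prop :=
  ∀ (j : ℕ) (hj : j < u.length), ∃ q, P.Asks α (a :: u.take j) q ∧ u[j] ∈ β.1 q

/-- `αβ(a) = c`: there is an `a`-interrogation of `β` by `α` with output `c`. -/
def AppVal (α β : BFun A) (a c : A) : Prop :=
  ∃ u : List A, P.Answers α β a u ∧ P.Returns α (a :: u) c

theorem asks_unique {α : BFun A} {l : List A} {q q' : A}
    (h : P.Asks α l q) (h' : P.Asks α l q') : q = q' := by
  obtain ⟨m, hm, -, hq⟩ := h
  obtain ⟨m', hm', -, hq'⟩ := h'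
  obtain rfl := Part.mem_unique hm hm'
  exact Part.mem_unique hq hq'

theorem returns_unique {α : BFun A} {l : List A} {q q' : A}
    (h : P.Returns α l q) (h' : P.Returns α l q') : q = q' := by
  obtain ⟨m, hm, -, hq⟩ := h
  obtain ⟨m', hm', -, hq'⟩ := h'
  obtain rfl := Part.mem_unique hm hm'
  exact Part.mem_unique hq hq'

theorem not_asks_returns (hP : ¬ P.Semitrivial) {α : BFun A} {l : List A} {q c : A}
    (h : P.Asks α l q) (h' : P.Returns α l c) : False := by
  obtain ⟨m, hm, ⟨t, ht, htf⟩, -⟩ := h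
  obtain ⟨m', hm', ⟨t', ht', htt⟩, -⟩ := h'
  obtain rfl := Part.mem_unique hm hm'
  obtain rfl := Part.mem_unique ht ht'
  exact hP ⟨t, htt, htf⟩

theorem answers_take_eq {α β : BFun A} {a : A} {u v : List A} (hu : P.Answers α β a u)
    (hv : P.Answers α β a v) (j : ℕ) (hju : j ≤ u.length) (hjv : j ≤ v.length) :
    u.take j = v.take j := by
  induction j with
  | zero => simp
  | succ j ih =>
    have ih := ih (by omega) (by omega)
    obtain ⟨q, hq, hqu⟩ := hu j (by omega)
    obtain ⟨q', hq', hqv⟩ := hv j (by omega)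
    rw [← ih] at hq'
    obtain rfl := P.asks_unique hq hq'
    have hx := Part.mem_unique hqu hqv
    rw [List.take_succ_eq_append_getElem (by omega), List.take_succ_eq_append_getElem (by omega),
      ih, hx]

theorem appVal_unique (hP : ¬ P.Semitrivial) {α β : BFun A} {a c d : A}
    (hc : P.AppVal α β a c) (hd : P.AppVal α β a d) : c = d := by
  obtain ⟨u, hu, huc⟩ := hc
  obtain ⟨v, hv, hvd⟩ := hd
  have key : ∀ {u v : List A} {c : A}, P.Answers α β a u → P.Answers α β a v →
      P.Returns α (a :: u) c → v.length ≤ u.length := by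
    intro u v c hu hv hc
    by_contra! hlt
    have h := P.answers_take_eq hu hv u.length le_rfl hlt.le
    obtain ⟨q, hq, -⟩ := hv u.length hlt
    rw [← h, List.take_length] at hq
    exact P.not_asks_returns hP hq hc
  have hlen : u.length = v.length := le_antisymm (key hv hu hvd) (key hu hv huc)
  have h := P.answers_take_eq hu hv u.length le_rfl hlen.le
  rw [List.take_length, hlen, List.take_length] at h
  subst h
  exact P.returns_unique huc hvd

theorem asks_mono {α' α : BFun A} (hα : α' ≤ α) {l' l : List A}
    (hl : List.Forall₂ (· ≤ ·) l' l) {q : A} (h : P.Asks α l q) :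
    ∃ q', P.Asks α' l' q' ∧ q' ≤ q := by
  obtain ⟨m, hm, ⟨t, ht, htf⟩, hq⟩ := h
  obtain ⟨m', hm', hmm⟩ := ((α'.2 _ _ (P.code_mono hl)).trans (hα _)) m hm
  obtain ⟨t', ht', htt⟩ := P.app_mono _ _ _ _ le_rfl hmm t ht
  obtain ⟨q', hq', hqq⟩ := P.app_mono _ _ _ _ le_rfl hmm q hq
  exact ⟨q', ⟨m', hm', ⟨t', ht', htt.trans htf⟩, hq'⟩, hqq⟩

theorem returns_mono {α' α : BFun A} (hα : α' ≤ α) {l' l : List A}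
    (hl : List.Forall₂ (· ≤ ·) l' l) {q : A} (h : P.Returns α l q) :
    ∃ q', P.Returns α' l' q' ∧ q' ≤ q := by
  obtain ⟨m, hm, ⟨t, ht, htf⟩, hq⟩ := h
  obtain ⟨m', hm', hmm⟩ := ((α'.2 _ _ (P.code_mono hl)).trans (hα _)) m hm
  obtain ⟨t', ht', htt⟩ := P.app_mono _ _ _ _ le_rfl hmm t ht
  obtain ⟨q', hq', hqq⟩ := P.app_mono _ _ _ _ le_rfl hmm q hq
  exact ⟨q', ⟨m', hm', ⟨t', ht', htt.trans htf⟩, hq'⟩, hqq⟩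

theorem answers_concat {α β : BFun A} {a : A} {u : List A} {x : A} :
    P.Answers α β a (u ++ [x]) ↔
      P.Answers α β a u ∧ ∃ q, P.Asks α (a :: u) q ∧ x ∈ β.1 q := by
  constructor
  · intro h
    refine ⟨fun j hj => ?_, ?_⟩
    · have h' := h j (by simp; omega)
      rwa [List.take_append_of_le_length hj.le, List.getElem_append_left hj] at h'
    · have h' := h u.length (by simp)
      simpa using h'
  · rintro ⟨h, h'⟩ j hj
    by_cases hlt : j < u.length
    · rw [List.take_append_of_le_length hlt.le, List.getElem_append_left hlt]
      exact h j hlt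
    · have hj' : j = u.length := by simp at hj; omega
      subst hj'
      simpa using h'

theorem answers_mono {α' α β' β : BFun A} (hα : α' ≤ α) (hβ : β' ≤ β) {a' a : A} (ha : a' ≤ a)
    {u : List A} (hu : P.Answers α β a u) :
    ∃ u', P.Answers α' β' a' u' ∧ List.Forall₂ (· ≤ ·) u' u := by
  induction u using List.reverseRecOn with
  | nil => exact ⟨[], fun j hj => absurd hj (by simp), List.Forall₂.nil⟩
  | append_singleton u x ih =>
    obtain ⟨h, q, hq, hx⟩ := P.answers_concat.1 hu
    obtain ⟨u', hu', huu⟩ := ih h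
    obtain ⟨q', hq', hqq⟩ := P.asks_mono hα (List.Forall₂.cons ha huu) hq
    obtain ⟨x', hx', hxx⟩ := ((β'.2 _ _ hqq).trans (hβ q)) x hx
    exact ⟨u' ++ [x'], P.answers_concat.2 ⟨hu', q', hq', hx'⟩,
      List.rel_append huu (List.Forall₂.cons hxx List.Forall₂.nil)⟩

theorem appVal_mono {α' α β' β : BFun A} (hα : α' ≤ α) (hβ : β' ≤ β) {a' a : A} (ha : a' ≤ a)
    {c : A} (h : P.AppVal α β a c) : ∃ c', P.AppVal α' β' a' c' ∧ c' ≤ c := by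
  obtain ⟨u, hu, hc⟩ := h
  obtain ⟨u', hu', huu⟩ := P.answers_mono hα hβ ha hu
  obtain ⟨c', hc', hcc⟩ := P.returns_mono hα (List.Forall₂.cons ha huu) hc
  exact ⟨c', ⟨u', hu', hc'⟩, hcc⟩

/-- The partial function `αβ`. -/
noncomputable def bappFun (α β : BFun A) (a : A) : Part A :=
  ⟨∃ c, P.AppVal α β a c, fun h => h.choose⟩

theorem mem_bappFun (hP : ¬ P.Semitrivial) {α β : BFun A} {a c : A} :
    c ∈ P.bappFun α β a ↔ P.AppVal α β a c := by
  constructor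
  · rintro ⟨h, rfl⟩
    exact h.choose_spec
  · intro h
    have hex : ∃ c, P.AppVal α β a c := ⟨c, h⟩
    exact ⟨hex, P.appVal_unique hP hex.choose_spec h⟩

theorem bappFun_mono (hP : ¬ P.Semitrivial) {α' α β' β : BFun A} (hα : α' ≤ α) (hβ : β' ≤ β)
    {a' a : A} (ha : a' ≤ a) : Prec (P.bappFun α' β' a') (P.bappFun α β a) := by
  intro c hc
  obtain ⟨c', hc', hcc⟩ := P.appVal_mono hα hβ ha ((P.mem_bappFun hP).1 hc)
  exact ⟨c', (P.mem_bappFun hP).2 hc', hcc⟩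

/-- The (total) application `αβ` of elements of `𝓑A`. -/
noncomputable def bapp (hP : ¬ P.Semitrivial) (α β : BFun A) : BFun A :=
  ⟨P.bappFun α β, fun _ _ h => P.bappFun_mono hP le_rfl le_rfl h⟩

/-- `r` represents `α`: we have `ra ≼ α(a)` for all `a`. -/
def Represents (r : A) (α : BFun A) : Prop := ∀ a : A, Prec (P.app r a) (α.1 a)

/-- `α` is effectively representable. -/
def EffRepresentable (α : BFun A) : Prop := ∃ r ∈ P.sharp, P.Represents r α

/-- `𝓑A`, with its application, and the set of effectively representable functions as its
distinguished subset. -/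
noncomputable def B (hP : ¬ P.Semitrivial) : RelPAP (BFun A) where
  app α β := Part.some (P.bapp hP α β)
  app_mono α' α β' β hα hβ := by
    intro γ hγ
    rw [Part.mem_some_iff] at hγ
    subst hγ
    exact ⟨_, Part.mem_some _, fun a => P.bappFun_mono hP hα hβ le_rfl⟩
  sharp := {α | P.EffRepresentable α}

end PCA

/-! ### Applicative morphisms -/

/-- Application on downsets: `αβ` is defined iff `ab` is defined for all `a ∈ α` and `b ∈ β`, and
then it is the downwards closure of `{ab | a ∈ α, b ∈ β}`. -/
def PAP.dapp {B : Type*} [PartialOrder B] (Q : PAP B) (α β : LowerSet B) : Part (LowerSet B) :=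
  ⟨∀ a ∈ α, ∀ b ∈ β, (Q.app a b).Dom,
    fun _ => lowerClosure {c | ∃ a ∈ α, ∃ b ∈ β, c ∈ Q.app a b}⟩

/-- A partial applicative morphism from `P` to `Q`, as a property of a function from `A` to the
downsets of `B`; here `t · f(a)` stands for `↓{t} · f(a)`. -/
structure IsPartialApplicativeMorphism {A B : Type*} [PartialOrder A] [PartialOrder B]
    (P : RelPAP A) (Q : RelPAP B) (f : A → LowerSet B) : Prop where
  sharp : ∀ a ∈ P.sharp, ((f a : Set B) ∩ Q.sharp).Nonempty
  tracker : ∃ t ∈ Q.sharp, ∀ a a' : A, ∀ c ∈ P.app a a',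
    ∃ δ ∈ (Q.dapp (LowerSet.Iic t) (f a)).bind (fun γ => Q.dapp γ (f a')), δ ≤ f c
  order : ∃ u ∈ Q.sharp, ∀ a : A, (Q.dapp (LowerSet.Iic u) (f a)).Dom ∧
    ∀ a' : A, a ≤ a' → ∀ δ ∈ Q.dapp (LowerSet.Iic u) (f a), δ ≤ f a'

/-- `f` is total: `f a` is non-empty for all `a`. -/
def IsTotal {A B : Type*} [PartialOrder B] (f : A → LowerSet B) : Prop :=
  ∀ a : A, (f a : Set B).Nonempty

/-- `f` is computationally dense: there is an `n ∈ B^#` such that for all `s ∈ B^#` there is an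
`r ∈ A^#` for which `n · f(r)` is defined and contained in `↓{s}`. -/
def IsComputationallyDense {A B : Type*} [PartialOrder A] [PartialOrder B]
    (P : RelPAP A) (Q : RelPAP B) (f : A → LowerSet B) : Prop :=
  ∃ n ∈ Q.sharp, ∀ s ∈ Q.sharp, ∃ r ∈ P.sharp,
    ∃ δ ∈ Q.dapp (LowerSet.Iic n) (f r), δ ≤ LowerSet.Iic s

end ROPCA

namespace ROPCA

/-! Elements of `𝓑A` are interrogators, and `αβ` is what `α` computes with oracle `β`. The
combinators are found by showing that enough operators `δ ↦ ρδ`, with `ρ` effectively representable,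
exist. Such operators are conveniently programmed as machines whose state survives from one question
to the next, whereas an interrogator sees only the input and the answers so far.
`exists_interrogator` bridges the gap: the interrogator replays the computation from the start after
every answer. The programs themselves come from the recursion theorem in `A` (`exists_rec`).

Three closure properties then suffice: reindexing of an oracle (`exists_reindex`), pointwise
application `δ ↦ (σδ)(τδ)` (`exists_bapp_bapp`), and currying with respect to joins of oracles
(`exists_curry`). For currying, `ργ` on `[a, us]` simulates `σ`, puts left questions to `γ` and
takes the answers to right questions from `us`; once `us` is exhausted it outputs the next right
question, so that `γ'` gets asked. Now `k` is the curried left projection of a join, and `s` the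
twice curried operator built from the three projections of `(α ∨ β) ∨ γ` by pointwise application.

For the constant functions, an oracle `â` yields `a` at any question. A tracker queries both halves
of a join and applies one answer to the other; density is witnessed by the operator that queries `r`
and returns `rx`.

Equations in `A` hold only up to `≤`, so correctness of programs is stated by upper bounds (`Maps`,
`Ev`), and monotonicity absorbs questions and answers that come out smaller than planned. -/

/-- All constants of the term belong to `S`. -/
def Term.ConstsIn {A : Type*} (S : Set A) : Term A → Prop
  | .var _ => True
  | .const a => a ∈ S
  | .app t u => t.ConstsIn S ∧ u.ConstsIn S

@[simp] theorem constsIn_var {A : Type*} {S : Set A} (n : ℕ) :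
    (Term.var n : Term A).ConstsIn S := trivial

@[simp] theorem constsIn_const {A : Type*} {S : Set A} {a : A} :
    (Term.const a).ConstsIn S ↔ a ∈ S := Iff.rfl

@[simp] theorem constsIn_app {A : Type*} {S : Set A} {t u : Term A} :
    (Term.app t u).ConstsIn S ↔ t.ConstsIn S ∧ u.ConstsIn S := Iff.rfl

/-! ### Values up to the order, and effectivity of terms. -/

namespace PCA

variable {A : Type*} [PartialOrder A] (P : PCA A)

/-- `f` sends `x` to a value below `y`. -/
def Maps (f x y : A) : Prop := ∃ m ∈ P.app f x, m ≤ y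

/-- The term `t` has a value below `y` under the assignment `ρ`. -/
def Ev (ρ : ℕ → A) (t : Term A) (y : A) : Prop := ∃ m ∈ P.eval ρ t, m ≤ y

variable {P}

/-- Shrinking the function and the argument preserves the bound. This is what lets correctness
statements be chained although each one only bounds a value from above. -/
theorem Maps.mono {f f' x x' y y' : A} (h : P.Maps f x y) (hf : f' ≤ f) (hx : x' ≤ x)
    (hy : y ≤ y') : P.Maps f' x' y' := by
  obtain ⟨m, hm, hmy⟩ := h
  obtain ⟨m', hm', hmm⟩ := P.app_mono _ _ _ _ hf hx m hm
  exact ⟨m', hm', (hmm.trans hmy).trans hy⟩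

theorem Ev.var (ρ : ℕ → A) (n : ℕ) : P.Ev ρ (.var n) (ρ n) :=
  ⟨ρ n, Part.mem_some _, le_rfl⟩

theorem Ev.const (ρ : ℕ → A) (a : A) : P.Ev ρ (.const a) a :=
  ⟨a, Part.mem_some _, le_rfl⟩

theorem Ev.app {ρ : ℕ → A} {t u : Term A} {f x y : A} (ht : P.Ev ρ t f) (hu : P.Ev ρ u x)
    (h : P.Maps f x y) : P.Ev ρ (.app t u) y := by
  obtain ⟨f', hf', hff⟩ := ht
  obtain ⟨x', hx', hxx⟩ := hu
  obtain ⟨m, hm, hmy⟩ := h.mono hff hxx le_rfl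
  refine ⟨m, ?_, hmy⟩
  simp only [PAP.eval, PAP.ap, Part.mem_bind_iff]
  exact ⟨f', hf', x', hx', hm⟩

theorem mem_ap_some {P : PAP A} {x : Part A} {b c : A} :
    c ∈ P.ap x (Part.some b) ↔ ∃ a ∈ x, c ∈ P.app a b := by
  simp [PAP.ap]

theorem app_mem {a b c : A} (ha : a ∈ P.sharp) (hb : b ∈ P.sharp) (hc : c ∈ P.app a b) :
    c ∈ P.sharp :=
  P.isPAS.app_closed a ha b hb c hc

theorem ap_some_mem {a b c d : A} (ha : a ∈ P.sharp) (hb : b ∈ P.sharp) (hc : c ∈ P.sharp)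
    (hd : d ∈ P.ap (P.app a b) (Part.some c)) : d ∈ P.sharp := by
  obtain ⟨e, he, hd⟩ := mem_ap_some.1 hd
  exact app_mem (app_mem ha hb he) hc hd

variable (P)

@[simp] theorem i_mem : P.i ∈ P.sharp :=
  ap_some_mem P.s_mem P.k_mem P.k_mem (Part.get_mem P.skk_dom)

@[simp] theorem tt_mem : P.tt ∈ P.sharp := P.k_mem

@[simp] theorem ff_mem : P.ff ∈ P.sharp :=
  app_mem P.k_mem P.i_mem (Part.get_mem (P.ka_dom P.i))

@[simp] theorem lam_constsIn {x : ℕ} {t : Term A} :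
    (P.lam x t).ConstsIn P.sharp ↔ t.ConstsIn P.sharp := by
  induction t with
  | var y => by_cases hy : y = x <;> simp [lam, hy, P.k_mem]
  | const a => simp [lam, P.k_mem]
  | app t u ht hu => simp [lam, P.s_mem, ht, hu]

/-- The filter is closed under application. Effectivity of every later program thereby reduces to
inspecting its constants. -/
theorem eval_mem {ρ : ℕ → A} (hρ : ∀ n, ρ n ∈ P.sharp) {t : Term A} (h : t.ConstsIn P.sharp)
    {m : A} (hm : m ∈ P.eval ρ t) : m ∈ P.sharp := by
  induction t generalizing m with
  | var y => exact (Part.mem_some_iff.1 hm) ▸ hρ y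
  | const a => exact (Part.mem_some_iff.1 hm) ▸ h
  | app t u ht hu =>
    simp only [PAP.eval, PAP.ap, Part.mem_bind_iff] at hm
    obtain ⟨a, ha, b, hb, hm⟩ := hm
    exact app_mem (ht h.1 ha) (hu h.2 hb) hm

theorem lamVal_mem (x : ℕ) {t : Term A} (h : t.ConstsIn P.sharp) : P.lamVal x t ∈ P.sharp :=
  P.eval_mem (fun _ => P.k_mem) (P.lam_constsIn.2 h) (Part.get_mem _)

@[simp] theorem p_mem : P.p ∈ P.sharp :=
  P.lamVal_mem _ (by simp)

@[simp] theorem p₀_mem : P.p₀ ∈ P.sharp := P.lamVal_mem _ (by simp)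

@[simp] theorem p₁_mem : P.p₁ ∈ P.sharp := P.lamVal_mem _ (by simp)

theorem pair_mem {a b : A} (ha : a ∈ P.sharp) (hb : b ∈ P.sharp) : P.pair a b ∈ P.sharp :=
  ap_some_mem P.p_mem ha hb (Part.get_mem (P.p_dom a b))

@[simp] theorem code_nil_mem : P.code [] ∈ P.sharp := P.pair_mem P.i_mem P.i_mem

theorem lamVal_app (x : ℕ) (t : Term A) (a : A) :
    Prec (P.app (P.lamVal x t) a) (P.eval (Function.update (fun _ => P.k) x a) t) := by
  have h := P.lam_app (fun _ => P.k) x t a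
  have h5 : P.eval (fun _ => P.k) (P.lam x t) = Part.some (P.lamVal x t) :=
    (Part.some_get (P.lam_dom _ _ _)).symm
  rw [h5] at h
  simpa [PAP.ap] using h

theorem tt_app (a b : A) : ∃ c ∈ P.ap (P.app P.tt a) (Part.some b), c ≤ a := P.comb.k_le a b

theorem ff_app (a b : A) : ∃ c ∈ P.ap (P.app P.ff a) (Part.some b), c ≤ b := by
  obtain ⟨c, hc, hci⟩ := P.comb.k_le P.i a
  obtain ⟨f, hf, hc⟩ := mem_ap_some.1 hc
  have hff : f = P.ff := Part.mem_unique hf (Part.get_mem (P.ka_dom P.i))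
  subst hff
  obtain ⟨d, hd, hdb⟩ := P.i_app b
  obtain ⟨e, he, hed⟩ := P.app_mono c P.i b b hci le_rfl d hd
  exact ⟨e, mem_ap_some.2 ⟨c, hc, he⟩, hed.trans hdb⟩

theorem pair_app (a b z : A) :
    Prec (P.app (P.pair a b) z) (P.ap (P.app z a) (Part.some b)) := by
  have h1 := P.lamVal_app 0 (P.lam 1 (P.lam 2 (.app (.app (.var 2) (.var 0)) (.var 1)))) a
  have h2 := P.lam_app (Function.update (fun _ => P.k) 0 a) 1
    (P.lam 2 (.app (.app (.var 2) (.var 0)) (.var 1))) b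
  have h3 := P.lam_app (Function.update (Function.update (fun _ => P.k) 0 a) 1 b) 2
    (.app (.app (.var 2) (.var 0)) (.var 1)) z
  have h4 := (P.ap_mono ((P.ap_mono h1 (Prec.refl (Part.some b))).trans h2)
    (Prec.refl (Part.some z))).trans h3
  have h5 : P.ap (P.app P.p a) (Part.some b) = Part.some (P.pair a b) :=
    (Part.some_get (P.p_dom a b)).symm
  change Prec (P.ap (P.ap (P.app P.p a) (Part.some b)) (Part.some z)) _ at h4
  rw [h5] at h4
  simpa [PAP.ap, PAP.eval, Function.update] using h4

theorem p₀_app (x : A) : Prec (P.app P.p₀ x) (P.app x P.tt) := by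
  have h := P.lamVal_app 0 (.app (.var 0) (.const P.tt)) x
  simpa [PAP.eval, PAP.ap, ← p₀.eq_def] using h

theorem p₁_app (x : A) : Prec (P.app P.p₁ x) (P.app x P.ff) := by
  have h := P.lamVal_app 0 (.app (.var 0) (.const P.ff)) x
  simpa [PAP.eval, PAP.ap, ← p₁.eq_def] using h

theorem maps_i (a : A) : P.Maps P.i a a := P.i_app a

theorem maps_p₀ (a b : A) : P.Maps P.p₀ (P.pair a b) a := by
  obtain ⟨c, hc, hca⟩ := P.tt_app a b
  obtain ⟨d, hd, hdc⟩ := (P.p₀_app _).trans (P.pair_app a b P.tt) c hc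
  exact ⟨d, hd, hdc.trans hca⟩

theorem maps_p₁ (a b : A) : P.Maps P.p₁ (P.pair a b) b := by
  obtain ⟨c, hc, hca⟩ := P.ff_app a b
  obtain ⟨d, hd, hdc⟩ := (P.p₁_app _).trans (P.pair_app a b P.ff) c hc
  exact ⟨d, hd, hdc.trans hca⟩

/-- This makes `p₀` a zero test: the numeral `0` is `i` and `i⊤ ≤ ⊤`, whereas a successor is a pair
with first component `⊥`. -/
theorem maps_p₀_i : P.Maps P.p₀ P.i P.tt := by
  obtain ⟨c, hc, hca⟩ := P.i_app P.tt
  obtain ⟨d, hd, hdc⟩ := P.p₀_app _ c hc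
  exact ⟨d, hd, hdc.trans hca⟩

/-! ### A small programming language -/

/-- The term for `p₀ t`. -/
def fst (t : Term A) : Term A := .app (.const P.p₀) t

/-- The term for `p₁ t`. -/
def snd (t : Term A) : Term A := .app (.const P.p₁) t

/-- The term for `p t u`. -/
def mkPair (t u : Term A) : Term A := .app (.app (.const P.p) t) u

/-- Definition by cases on the boolean `b`; only the selected branch has to be defined. -/
def cond (b t u : Term A) : Term A := .app (.app (.app b (P.lam 0 t)) (P.lam 0 u)) (.var 0)

/-- The head of a coded sequence. -/
def hd (t : Term A) : Term A := P.fst (P.snd t)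

/-- The tail of a coded sequence. -/
def tl (t : Term A) : Term A := P.mkPair (P.snd (P.fst t)) (P.snd (P.snd t))

/-- Test whether a coded sequence is empty. -/
def isNil (t : Term A) : Term A := P.fst (P.fst t)

/-- The coded sequence with head `t` and tail `u`. -/
def cons (t u : Term A) : Term A :=
  P.mkPair (P.mkPair (.const P.ff) (P.fst u)) (P.mkPair t (P.snd u))

variable {P}

@[simp] theorem constsIn_fst {t : Term A} :
    (P.fst t).ConstsIn P.sharp ↔ t.ConstsIn P.sharp := by
  simp [fst]

@[simp] theorem constsIn_snd {t : Term A} :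
    (P.snd t).ConstsIn P.sharp ↔ t.ConstsIn P.sharp := by
  simp [snd]

@[simp] theorem constsIn_mkPair {t u : Term A} :
    (P.mkPair t u).ConstsIn P.sharp ↔ t.ConstsIn P.sharp ∧ u.ConstsIn P.sharp := by
  simp [mkPair]

@[simp] theorem constsIn_cond {b t u : Term A} :
    (P.cond b t u).ConstsIn P.sharp ↔ b.ConstsIn P.sharp ∧ t.ConstsIn P.sharp ∧ u.ConstsIn P.sharp := by
  simp [cond, and_assoc]

@[simp] theorem constsIn_hd {t : Term A} :
    (P.hd t).ConstsIn P.sharp ↔ t.ConstsIn P.sharp := by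
  simp [hd]

@[simp] theorem constsIn_tl {t : Term A} :
    (P.tl t).ConstsIn P.sharp ↔ t.ConstsIn P.sharp := by
  simp [tl]

@[simp] theorem constsIn_isNil {t : Term A} :
    (P.isNil t).ConstsIn P.sharp ↔ t.ConstsIn P.sharp := by
  simp [isNil]

@[simp] theorem constsIn_cons {t u : Term A} :
    (P.cons t u).ConstsIn P.sharp ↔ t.ConstsIn P.sharp ∧ u.ConstsIn P.sharp := by
  simp [cons]

section

variable {ρ : ℕ → A}

theorem Ev.fst' {t : Term A} {m y : A} (h : P.Ev ρ t m) (hm : P.Maps P.p₀ m y) :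
    P.Ev ρ (P.fst t) y :=
  (Ev.const ρ _).app h hm

theorem Ev.snd' {t : Term A} {m y : A} (h : P.Ev ρ t m) (hm : P.Maps P.p₁ m y) :
    P.Ev ρ (P.snd t) y :=
  (Ev.const ρ _).app h hm

theorem Ev.fst {t : Term A} {y z : A} (h : P.Ev ρ t (P.pair y z)) : P.Ev ρ (P.fst t) y :=
  h.fst' (P.maps_p₀ y z)

theorem Ev.snd {t : Term A} {y z : A} (h : P.Ev ρ t (P.pair y z)) : P.Ev ρ (P.snd t) z :=
  h.snd' (P.maps_p₁ y z)

theorem Ev.mkPair {t u : Term A} {y z : A} (ht : P.Ev ρ t y) (hu : P.Ev ρ u z) :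
    P.Ev ρ (P.mkPair t u) (P.pair y z) := by
  obtain ⟨f, hf, h⟩ := mem_ap_some.1 (Part.get_mem (P.p_dom y z))
  exact ((Ev.const ρ _).app ht ⟨f, hf, le_rfl⟩).app hu ⟨_, h, le_rfl⟩

/-- A branch of `cond` is suspended by abstracting variable `0` and resumed by applying it to the
current value of that same variable, so the updated assignment is the original one. -/
theorem ev_lam_app (t : Term A) {m y : A} (hm : m ∈ P.eval ρ (P.lam 0 t)) (h : P.Ev ρ t y) :
    P.Maps m (ρ 0) y := by
  obtain ⟨v, hv, hvy⟩ := h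
  have hl := P.lam_app ρ 0 t (ρ 0)
  rw [Function.update_eq_self] at hl
  obtain ⟨w, hw, hwv⟩ := hl v hv
  obtain ⟨m', hm', hw⟩ := mem_ap_some.1 hw
  obtain rfl := Part.mem_unique hm hm'
  exact ⟨w, hw, hwv.trans hvy⟩

theorem Ev.cond_tt {b t u : Term A} {y : A} (hb : P.Ev ρ b P.tt) (ht : P.Ev ρ t y) :
    P.Ev ρ (P.cond b t u) y := by
  obtain ⟨v, hv⟩ := Part.dom_iff_mem.1 (P.lam_dom ρ 0 t)
  obtain ⟨w, hw⟩ := Part.dom_iff_mem.1 (P.lam_dom ρ 0 u)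
  obtain ⟨c, hc, hcv⟩ := P.tt_app v w
  obtain ⟨f, hf, hc⟩ := mem_ap_some.1 hc
  exact (((hb.app ⟨v, hv, le_rfl⟩ ⟨f, hf, le_rfl⟩).app ⟨w, hw, le_rfl⟩ ⟨c, hc, hcv⟩).app
    (Ev.var ρ 0) (ev_lam_app t hv ht))

theorem Ev.cond_ff {b t u : Term A} {y : A} (hb : P.Ev ρ b P.ff) (hu : P.Ev ρ u y) :
    P.Ev ρ (P.cond b t u) y := by
  obtain ⟨v, hv⟩ := Part.dom_iff_mem.1 (P.lam_dom ρ 0 t)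
  obtain ⟨w, hw⟩ := Part.dom_iff_mem.1 (P.lam_dom ρ 0 u)
  obtain ⟨c, hc, hcv⟩ := P.ff_app v w
  obtain ⟨f, hf, hc⟩ := mem_ap_some.1 hc
  exact (((hb.app ⟨v, hv, le_rfl⟩ ⟨f, hf, le_rfl⟩).app ⟨w, hw, le_rfl⟩ ⟨c, hc, hcv⟩).app
    (Ev.var ρ 0) (ev_lam_app u hw hu))

theorem Ev.hd {t : Term A} {a : A} {l : List A} (h : P.Ev ρ t (P.code (a :: l))) :
    P.Ev ρ (P.hd t) a :=
  Ev.fst (Ev.snd h)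

theorem Ev.tl {t : Term A} {a : A} {l : List A} (h : P.Ev ρ t (P.code (a :: l))) :
    P.Ev ρ (P.tl t) (P.code l) :=
  Ev.mkPair (Ev.snd (Ev.fst h)) (Ev.snd (Ev.snd h))

theorem Ev.isNil_nil {t : Term A} (h : P.Ev ρ t (P.code [])) : P.Ev ρ (P.isNil t) P.tt :=
  (Ev.fst h).fst' P.maps_p₀_i

theorem Ev.isNil_cons {t : Term A} {a : A} {l : List A} (h : P.Ev ρ t (P.code (a :: l))) :
    P.Ev ρ (P.isNil t) P.ff :=
  Ev.fst (Ev.fst h)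

theorem Ev.cons {t u : Term A} {a : A} {l : List A} (ht : P.Ev ρ t a)
    (hu : P.Ev ρ u (P.code l)) : P.Ev ρ (P.cons t u) (P.code (a :: l)) :=
  Ev.mkPair (Ev.mkPair (Ev.const _ _) hu.fst) (Ev.mkPair ht hu.snd)

end

/-! ### The recursion theorem and a first recursive program. -/

/-- The assignment `0 ↦ a`, `1 ↦ y`. -/
def env (P : PCA A) (a y : A) : ℕ → A :=
  Function.update (Function.update (fun _ => P.k) 1 y) 0 a

theorem Ev.env_zero (a y : A) : P.Ev (P.env a y) (.var 0) a := by
  simpa [env] using Ev.var (P := P) (P.env a y) 0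

theorem Ev.env_one (a y : A) : P.Ev (P.env a y) (.var 1) y := by
  simpa [env, Function.update] using Ev.var (P := P) (P.env a y) 1

/-- The recursion theorem: `t` defines an effective function of variable `0`, in which
variable `1` stands for that function itself. -/
theorem exists_rec {t : Term A} (ht : t.ConstsIn P.sharp) :
    ∃ y ∈ P.sharp, ∀ a v, P.Ev (P.env a y) t v → P.Maps y a v := by
  set f := P.lamVal 1 (P.lam 0 t) with hf
  have hfm : f ∈ P.sharp := P.lamVal_mem _ (P.lam_constsIn.2 ht)
  have hfy : ∀ y a, Prec (P.ap (P.app f y) (Part.some a)) (P.eval (P.env a y) t) := fun y a =>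
    (P.ap_mono (P.lamVal_app 1 (P.lam 0 t) y) (Prec.refl _)).trans (P.lam_app _ 0 t a)
  -- The fixed point is `y = ww` with `w = λ*y. λ*x. f(yy)x`. The inner abstraction delays the
  -- self-application: `ww` is bounded by an abstraction, and abstractions always denote.
  set w := P.lamVal 1 (P.lam 0 (.app (.app (.const f) (.app (.var 1) (.var 1))) (.var 0))) with hw
  have hwm : w ∈ P.sharp := P.lamVal_mem _ (by simpa using hfm)
  have hww := P.lamVal_app 1
    (P.lam 0 (.app (.app (.const f) (.app (.var 1) (.var 1))) (.var 0))) w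
  obtain ⟨y, hy⟩ := Part.dom_iff_mem.1 (hww.dom (P.lam_dom _ _ _))
  rw [← hw] at hy hww
  refine ⟨y, app_mem hwm hwm hy, fun a v hv => ?_⟩
  have h := (P.ap_mono hww (Prec.refl (Part.some a))).trans (P.lam_app _ 0 _ a)
  rw [Part.eq_some_iff.2 hy] at h
  have h' : Prec (P.app y a) (P.ap (P.app f y) (Part.some a)) := by
    simpa [PAP.eval, PAP.ap, Function.update, Part.eq_some_iff.2 hy] using h
  obtain ⟨m, hm, hmv⟩ := hv
  obtain ⟨m', hm', hmm⟩ := h'.trans (hfy y a) m hm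
  exact ⟨m', hm', hmm.trans hmv⟩

/-- Appending an element to a coded sequence is effective. -/
theorem exists_snoc (P : PCA A) :
    ∃ r ∈ P.sharp, ∀ l u, P.Maps r (P.pair (P.code l) u) (P.code (l ++ [u])) := by
  obtain ⟨r, hr, h⟩ := exists_rec (P := P)
    (t := P.cond (P.isNil (P.fst (.var 0)))
      (P.cons (P.snd (.var 0)) (.const (P.code [])))
      (P.cons (P.hd (P.fst (.var 0)))
        (.app (.var 1) (P.mkPair (P.tl (P.fst (.var 0))) (P.snd (.var 0))))))
    (by simp)
  refine ⟨r, hr, fun l u => ?_⟩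
  induction l with
  | nil =>
    refine h _ _ ?_
    have h0 := Ev.env_zero (P := P) (P.pair (P.code []) u) r
    exact Ev.cond_tt h0.fst.isNil_nil (h0.snd.cons (Ev.const _ _))
  | cons a l ih =>
    refine h _ _ ?_
    have h0 := Ev.env_zero (P := P) (P.pair (P.code (a :: l)) u) r
    exact Ev.cond_ff h0.fst.isNil_cons
      (h0.fst.hd.cons ((Ev.env_one _ _).app (h0.fst.tl.mkPair h0.snd) ih))

/-! ### Interrogations -/

/-- The function `a ↦ ra`, as an element of `𝓑A`. -/
def toBFun (P : PCA A) (r : A) : BFun A := ⟨P.app r, fun _ _ h => P.app_mono _ _ _ _ le_rfl h⟩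

theorem toBFun_effRepresentable {r : A} (hr : r ∈ P.sharp) : P.EffRepresentable (P.toBFun r) :=
  ⟨r, hr, fun _ => Prec.refl _⟩

theorem Maps.of_represents {r x m : A} {α : BFun A} (hr : P.Represents r α) (hm : m ∈ α.1 x) :
    P.Maps r x m :=
  hr x m hm

/-- A reply merely below the intended pair suffices: its flag is still below `⊥`, and the question
can only become smaller. -/
theorem asks_toBFun {r : A} {l : List A} {q : A} (h : P.Maps r (P.code l) (P.pair P.ff q)) :
    ∃ q', P.Asks (P.toBFun r) l q' ∧ q' ≤ q := by
  obtain ⟨m, hm, hmq⟩ := h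
  obtain ⟨t, ht, htf⟩ := (P.maps_p₀ P.ff q).mono le_rfl hmq le_rfl
  obtain ⟨q', hq, hqq⟩ := (P.maps_p₁ P.ff q).mono le_rfl hmq le_rfl
  exact ⟨q', ⟨m, hm, ⟨t, ht, htf⟩, hq⟩, hqq⟩

theorem returns_toBFun {r : A} {l : List A} {q : A}
    (h : P.Maps r (P.code l) (P.pair P.tt q)) :
    ∃ q', P.Returns (P.toBFun r) l q' ∧ q' ≤ q := by
  obtain ⟨m, hm, hmq⟩ := h
  obtain ⟨t, ht, htf⟩ := (P.maps_p₀ P.tt q).mono le_rfl hmq le_rfl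
  obtain ⟨q', hq, hqq⟩ := (P.maps_p₁ P.tt q).mono le_rfl hmq le_rfl
  exact ⟨q', ⟨m, hm, ⟨t, ht, htf⟩, hq⟩, hqq⟩

theorem answers_nil {α β : BFun A} {a : A} : P.Answers α β a [] :=
  fun _ hj => absurd hj (Nat.not_lt_zero _)

/-! ### Machines with an oracle and their implementation by interrogators. -/

/-- Computations of the machine with transition function `e` and oracle `δ`: from the state `x`,
the machine either moves silently to another state, or puts a question `q` to the oracle and
moves to a state composed of a memory `y` and the answer, or returns a result. -/
inductive Run (P : PCA A) (e : A) (δ : BFun A) : A → A → Prop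
  | ret {x c z : A} (h : P.Maps e x (P.pair P.ff (P.pair (P.pair P.tt c) z))) : Run P e δ x c
  | step {x x' c : A} (h : P.Maps e x (P.pair P.tt x')) (hr : Run P e δ x' c) : Run P e δ x c
  | ask {x q y u c : A} (h : P.Maps e x (P.pair P.ff (P.pair (P.pair P.ff q) y)))
      (hu : u ∈ δ.1 q) (hr : Run P e δ (P.pair y u) c) : Run P e δ x c

/-- Only the first transition mentions the initial state, so no induction is needed. -/
theorem Run.mono {e x x' c : A} {δ : BFun A} (h : P.Run e δ x c) (hx : x' ≤ x) :
    P.Run e δ x' c := by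
  cases h with
  | ret h => exact .ret (h.mono le_rfl hx le_rfl)
  | step h hr => exact .step (h.mono le_rfl hx le_rfl) hr
  | ask h hu hr => exact .ask (h.mono le_rfl hx le_rfl) hu hr

/-- Every machine is implemented by an interrogator, which replays the computation from the
start after every answer. -/
theorem exists_interrogator {e ι : A} (he : e ∈ P.sharp) (hι : ι ∈ P.sharp) :
    ∃ ρ, P.EffRepresentable ρ ∧ ∀ δ a x c, P.Maps ι a x → P.Run e δ x c →
      ∃ c', P.AppVal ρ δ a c' ∧ c' ≤ c := by
  -- `w` acts on a state paired with the unused answers. A silent move loops. Otherwise, with no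
  -- answers left, it emits the flag and datum, already in the format of an interrogator's reply;
  -- with an answer left, it feeds that answer to the machine and continues.
  obtain ⟨w, hw, hW⟩ := exists_rec (P := P)
    (t := P.cond (P.fst (.app (.const e) (P.fst (.var 0))))
      (.app (.var 1) (P.mkPair (P.snd (.app (.const e) (P.fst (.var 0)))) (P.snd (.var 0))))
      (P.cond (P.isNil (P.snd (.var 0)))
        (P.fst (P.snd (.app (.const e) (P.fst (.var 0)))))
        (.app (.var 1) (P.mkPair
          (P.mkPair (P.snd (P.snd (.app (.const e) (P.fst (.var 0))))) (P.hd (P.snd (.var 0))))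
          (P.tl (P.snd (.var 0)))))))
    (by simpa using he)
  obtain ⟨r, hr, hR⟩ := exists_rec (P := P)
    (t := .app (.const w) (P.mkPair (.app (.const ι) (P.hd (.var 0))) (P.tl (.var 0))))
    (by simpa using ⟨hw, hι⟩)
  refine ⟨P.toBFun r, toBFun_effRepresentable hr, fun δ a x c hx hrun => ?_⟩
  -- Here `us` are the answers consumed before reaching `x`. The invariant says that replaying `a,
  -- us` leads to `x`: any bound for `w` at `x` with `l` left is a bound for `r` on `a, us, l`.
  have key : ∀ {x c : A}, P.Run e δ x c → ∀ us, P.Answers (P.toBFun r) δ a us →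
      (∀ l v, P.Maps w (P.pair x (P.code l)) v → P.Maps r (P.code (a :: (us ++ l))) v) →
      ∃ c', P.AppVal (P.toBFun r) δ a c' ∧ c' ≤ c := by
    intro x c hrun
    induction hrun with
    | @ret x c z h =>
      intro us hus hinv
      have h0 := Ev.env_zero (P := P) (P.pair x (P.code [])) w
      have hm := (Ev.const _ e).app h0.fst h
      have h1 := hinv [] _ (hW _ _ (Ev.cond_ff hm.fst (Ev.cond_tt h0.snd.isNil_nil hm.snd.fst)))
      rw [List.append_nil] at h1
      obtain ⟨c', hc', hcc⟩ := returns_toBFun h1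
      exact ⟨c', ⟨us, hus, hc'⟩, hcc⟩
    | @step x x' c h _ ih =>
      intro us hus hinv
      refine ih us hus fun l v hv => hinv l v (hW _ _ ?_)
      have h0 := Ev.env_zero (P := P) (P.pair x (P.code l)) w
      have hm := (Ev.const _ e).app h0.fst h
      exact Ev.cond_tt hm.fst ((Ev.env_one _ _).app (hm.snd.mkPair h0.snd) hv)
    | @ask x q y u c h hu _ ih =>
      intro us hus hinv
      have h1 : P.Maps r (P.code (a :: us)) (P.pair P.ff q) := by
        have h0 := Ev.env_zero (P := P) (P.pair x (P.code [])) w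
        have hm := (Ev.const _ e).app h0.fst h
        have h1 := hinv [] _ (hW _ _ (Ev.cond_ff hm.fst (Ev.cond_tt h0.snd.isNil_nil hm.snd.fst)))
        rwa [List.append_nil] at h1
      obtain ⟨q', hq', hqq⟩ := asks_toBFun h1
      obtain ⟨u', hu', huu⟩ := δ.2 _ _ hqq u hu
      refine ih (us ++ [u']) (answers_concat P |>.2 ⟨hus, q', hq', hu'⟩) fun l v hv => ?_
      rw [List.append_assoc]
      refine hinv (u' :: l) v (hW _ _ ?_)
      have h0 := Ev.env_zero (P := P) (P.pair x (P.code (u' :: l))) w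
      have hm := (Ev.const _ e).app h0.fst h
      refine Ev.cond_ff hm.fst (Ev.cond_ff h0.snd.isNil_cons ((Ev.env_one _ _).app
        ((hm.snd.snd.mkPair h0.snd.hd).mkPair h0.snd.tl) ?_))
      exact hv.mono le_rfl (P.pair_mono (P.pair_mono le_rfl huu) le_rfl) le_rfl
  refine key hrun [] answers_nil fun l v hv => hR _ _ ?_
  have h0 := Ev.env_zero (P := P) (P.code (a :: l)) r
  exact (Ev.const _ w).app (((Ev.const _ ι).app h0.hd hx).mkPair h0.tl) hv

/-- If a machine simulates the interrogations by `σ` of its oracle, keeping track of the answers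
in its memory `Y`, and continues once such an interrogation is completed, then it computes the
values of `σδ`. -/
theorem Run.of_appVal {e b c C : A} {σ δ : BFun A} {Y : List A → A}
    (hask : ∀ M u q, P.Asks σ (M ++ [u]) q → P.Maps e (P.pair (Y M) u)
      (P.pair P.ff (P.pair (P.pair P.ff q) (Y (M ++ [u])))))
    (hret : ∀ M u, P.Returns σ (M ++ [u]) c → P.Run e δ (P.pair (Y M) u) C)
    (h : P.AppVal σ δ b c) : P.Run e δ (P.pair (Y []) b) C := by
  obtain ⟨us, hus, hc⟩ := h
  -- The last entry of the log is the current input or answer; the machine keeps only the earlier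
  -- entries in its memory.
  have split : ∀ us : List A, ∃ M u, M ++ [u] = b :: us := fun us =>
    ⟨_, _, List.dropLast_append_getLast (List.cons_ne_nil b us)⟩
  -- The run is assembled backwards: removing the last answer prepends one question to the run
  -- already constructed.
  have key : ∀ us, P.Answers σ δ b us → ∀ M u, M ++ [u] = b :: us →
      P.Run e δ (P.pair (Y M) u) C → P.Run e δ (P.pair (Y []) b) C := by
    intro us
    induction us using List.reverseRecOn with
    | nil =>
      intro _ M u hM hrun
      obtain ⟨rfl, h⟩ := List.append_inj' (hM.trans (List.nil_append [b]).symm) rfl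
      obtain rfl := List.singleton_injective h
      exact hrun
    | append_singleton us x ih =>
      intro hus M u hM hrun
      obtain ⟨hus', q, hq, hx⟩ := P.answers_concat.1 hus
      obtain ⟨rfl, h⟩ := List.append_inj' (hM.trans (List.cons_append (bs := [x])).symm) rfl
      obtain rfl := List.singleton_injective h
      obtain ⟨M', u', hM'⟩ := split us
      rw [← hM'] at hq hrun
      exact ih hus' M' u' hM' (.ask (hask M' u' q hq) hx hrun)
  obtain ⟨M, u, hM⟩ := split us
  exact key us hus M u hM (hret M u (hM ▸ hc))

theorem Ev.asks {ρ : ℕ → A} {r q : A} {σ : BFun A} {l : List A} {t : Term A}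
    (hr : P.Represents r σ) (h : P.Asks σ l q) (ht : P.Ev ρ t (P.code l)) :
    P.Ev ρ (P.fst (.app (.const r) t)) P.ff ∧ P.Ev ρ (P.snd (.app (.const r) t)) q := by
  obtain ⟨m, hm, hf, hq⟩ := h
  have := (Ev.const ρ r).app ht (Maps.of_represents hr hm)
  exact ⟨this.fst' hf, this.snd' ⟨q, hq, le_rfl⟩⟩

theorem Ev.returns {ρ : ℕ → A} {r q : A} {σ : BFun A} {l : List A} {t : Term A}
    (hr : P.Represents r σ) (h : P.Returns σ l q) (ht : P.Ev ρ t (P.code l)) :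
    P.Ev ρ (P.fst (.app (.const r) t)) P.tt ∧ P.Ev ρ (P.snd (.app (.const r) t)) q := by
  obtain ⟨m, hm, hf, hq⟩ := h
  have := (Ev.const ρ r).app ht (Maps.of_represents hr hm)
  exact ⟨this.fst' hf, this.snd' ⟨q, hq, le_rfl⟩⟩

theorem Ev.snoc {ρ : ℕ → A} {sn u : A} {l : List A} {t t' : Term A}
    (hsn : ∀ l u, P.Maps sn (P.pair (P.code l) u) (P.code (l ++ [u])))
    (ht : P.Ev ρ t (P.code l)) (ht' : P.Ev ρ t' u) :
    P.Ev ρ (.app (.const sn) (P.mkPair t t')) (P.code (l ++ [u])) :=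
  (Ev.const ρ sn).app (ht.mkPair ht') (hsn l u)

theorem bapp_le_iff (hP : ¬ P.Semitrivial) {α β γ : BFun A} :
    P.bapp hP α β ≤ γ ↔ ∀ a, ∀ c ∈ γ.1 a, ∃ c', P.AppVal α β a c' ∧ c' ≤ c :=
  forall_congr' fun _ => forall₂_congr fun _ _ => exists_congr fun _ =>
    and_congr_left' (P.mem_bappFun hP)

theorem bapp_mono (hP : ¬ P.Semitrivial) {α α' β β' : BFun A} (hα : α' ≤ α) (hβ : β' ≤ β) :
    P.bapp hP α' β' ≤ P.bapp hP α β :=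
  fun _ => P.bappFun_mono hP hα hβ le_rfl

/-! ### Closure under application, and pointwise application of operators. -/

/-- The effectively representable functions are closed under application. -/
theorem EffRepresentable.bapp (hP : ¬ P.Semitrivial) {α β : BFun A} (hα : P.EffRepresentable α)
    (hβ : P.EffRepresentable β) : P.EffRepresentable (P.bapp hP α β) := by
  obtain ⟨a, ha, hra⟩ := hα
  obtain ⟨b, hb, hrb⟩ := hβ
  obtain ⟨sn, hsn, hs⟩ := P.exists_snoc
  let m : Term A := .app (.const a) (.var 0)
  -- `w` acts on the log of the interrogation: it returns when `a` says so, and otherwise computes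
  -- the answer with `b` and appends it. The oracle being effective, no machine is needed.
  obtain ⟨w, hw, hW⟩ := exists_rec (P := P)
    (t := P.cond (P.fst m) (P.snd m) (.app (.var 1)
      (.app (.const sn) (P.mkPair (.var 0) (.app (.const b) (P.snd m))))))
    (by simpa [m] using ⟨ha, hsn, hb, ha⟩)
  obtain ⟨r, hr, hR⟩ := exists_rec (P := P)
    (t := .app (.const w) (P.cons (.var 0) (.const (P.code []))))
    (by simpa using hw)
  refine ⟨r, hr, fun x c hc => ?_⟩
  obtain ⟨us, hus, hret⟩ := (P.mem_bappFun hP).1 hc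
  -- Answers are stripped from the end, so that a value of `w` at the complete log becomes a value
  -- at the initial log.
  have key : ∀ us, P.Answers α β x us → ∀ v, P.Maps w (P.code (x :: us)) v →
      P.Maps w (P.code [x]) v := by
    intro us
    induction us using List.reverseRecOn with
    | nil => exact fun _ v hv => hv
    | append_singleton us u ih =>
      intro hus v hv
      obtain ⟨hus, q, hq, hu⟩ := P.answers_concat.1 hus
      refine ih hus v (hW _ _ ?_)
      have h0 := Ev.env_zero (P := P) (P.code (x :: us)) w
      obtain ⟨h1, h2⟩ := Ev.asks hra hq h0
      exact Ev.cond_ff h1 ((Ev.env_one _ _).app (Ev.snoc hs h0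
        ((Ev.const _ _).app h2 (Maps.of_represents hrb hu))) hv)
  have h0 := Ev.env_zero (P := P) (P.code (x :: us)) w
  obtain ⟨h1, h2⟩ := Ev.returns hra hret h0
  exact hR _ _ ((Ev.const _ _).app ((Ev.env_zero _ _).cons (Ev.const _ _))
    (key us hus c (hW _ _ (Ev.cond_tt h1 h2))))

/-- Pointwise application of effective operators on `𝓑A` is effective. -/
theorem exists_bapp_bapp (hP : ¬ P.Semitrivial) {σ τ : BFun A} (hσ : P.EffRepresentable σ)
    (hτ : P.EffRepresentable τ) : ∃ ρ, P.EffRepresentable ρ ∧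
      ∀ δ, P.bapp hP ρ δ ≤ P.bapp hP (P.bapp hP σ δ) (P.bapp hP τ δ) := by
  obtain ⟨s, hs, hrs⟩ := hσ
  obtain ⟨t, ht, hrt⟩ := hτ
  obtain ⟨sn, hsn, hSn⟩ := P.exists_snoc
  -- `mode` is `⊤` while `σ` is simulated and `⊥` while `τ` is. `L` is the log of the outer
  -- interrogation of `τδ` by `σδ`, and `M` that of the inner interrogation of `δ`, including the
  -- latest entry.
  let mode : Term A := P.fst (P.fst (.var 0))
  let L : Term A := P.fst (P.snd (P.fst (.var 0)))
  let M : Term A :=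
    .app (.const sn) (P.mkPair (P.snd (P.snd (P.fst (.var 0)))) (P.snd (.var 0)))
  let m : Term A := .app (.const s) M
  let m' : Term A := .app (.const t) M
  let L' : Term A := .app (.const sn) (P.mkPair L (P.snd m'))
  let nil : Term A := .const (P.code [])
  -- Inner questions go to `δ`. A value returned by `σ` is an outer reply: with flag `⊤` the machine
  -- halts, with flag `⊥` it starts `τ` on the outer question. A value returned by `τ` is the outer
  -- answer: it is appended to `L`, and `σ` restarts on the code of the new log.
  obtain ⟨e, he, hE⟩ := exists_rec (P := P)
    (t := P.cond mode
      (P.cond (P.fst m)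
        (P.cond (P.fst (P.snd m))
          (P.mkPair (.const P.ff) (P.mkPair (P.mkPair (.const P.tt) (P.snd (P.snd m))) nil))
          (P.mkPair (.const P.tt)
            (P.mkPair (P.mkPair (.const P.ff) (P.mkPair L nil)) (P.snd (P.snd m)))))
        (P.mkPair (.const P.ff) (P.mkPair (P.mkPair (.const P.ff) (P.snd m))
          (P.mkPair (.const P.tt) (P.mkPair L M)))))
      (P.cond (P.fst m')
        (P.mkPair (.const P.tt) (P.mkPair (P.mkPair (.const P.tt) (P.mkPair L' nil)) L'))
        (P.mkPair (.const P.ff) (P.mkPair (P.mkPair (.const P.ff) (P.snd m'))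
          (P.mkPair (.const P.ff) (P.mkPair L M))))))
    (by simp [mode, L, M, m, m', L', nil, hs, ht, hsn])
  -- The code of `[a]` occurs twice: as the outer log and as the first input of `σ`.
  obtain ⟨ι, hι, hI⟩ := exists_rec (P := P)
    (t := P.mkPair (P.mkPair (.const P.tt) (P.mkPair (P.cons (.var 0) nil) nil))
      (P.cons (.var 0) nil))
    (by simp [nil])
  obtain ⟨ρ, hρ, H⟩ := exists_interrogator he hι
  refine ⟨ρ, hρ, fun δ => (bapp_le_iff hP).2 fun a C hC => ?_⟩
  obtain ⟨xs, hxs, hret⟩ := (P.mem_bappFun hP).1 hC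
  let Y : A → List A → List A → A := fun b l k => P.pair b (P.pair (P.code l) (P.code k))
  have hn : ∀ ρ, P.Ev ρ nil (P.code []) := fun ρ => Ev.const ρ _
  have ev : ∀ b l k u, P.Ev (P.env (P.pair (Y b l k) u) e) mode b ∧
      P.Ev (P.env (P.pair (Y b l k) u) e) L (P.code l) ∧
      P.Ev (P.env (P.pair (Y b l k) u) e) M (P.code (k ++ [u])) := fun b l k u => by
    have h0 := Ev.env_zero (P := P) (P.pair (Y b l k) u) e
    exact ⟨h0.fst.fst, h0.fst.snd.fst, Ev.snoc hSn h0.fst.snd.snd h0.snd⟩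
  have sask : ∀ l k u q, P.Asks σ (k ++ [u]) q → P.Maps e (P.pair (Y P.tt l k) u)
      (P.pair P.ff (P.pair (P.pair P.ff q) (Y P.tt l (k ++ [u])))) := by
    intro l k u q hq
    obtain ⟨h0, hL, hM⟩ := ev P.tt l k u
    obtain ⟨h1, h2⟩ := Ev.asks hrs hq hM
    exact hE _ _ (Ev.cond_tt h0 (Ev.cond_ff h1 ((Ev.const _ _).mkPair
      (((Ev.const _ _).mkPair h2).mkPair ((Ev.const _ _).mkPair (hL.mkPair hM))))))
  have task : ∀ l k u q, P.Asks τ (k ++ [u]) q → P.Maps e (P.pair (Y P.ff l k) u)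
      (P.pair P.ff (P.pair (P.pair P.ff q) (Y P.ff l (k ++ [u])))) := by
    intro l k u q hq
    obtain ⟨h0, hL, hM⟩ := ev P.ff l k u
    obtain ⟨h1, h2⟩ := Ev.asks hrt hq hM
    exact hE _ _ (Ev.cond_ff h0 (Ev.cond_ff h1 ((Ev.const _ _).mkPair
      (((Ev.const _ _).mkPair h2).mkPair ((Ev.const _ _).mkPair (hL.mkPair hM))))))
  -- Backward induction on the outer answers; each outer round is a completed simulation of `σ`
  -- followed by one of `τ`.
  have key : ∀ xs, P.Answers (P.bapp hP σ δ) (P.bapp hP τ δ) a xs →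
      P.Run e δ (P.pair (Y P.tt (a :: xs) []) (P.code (a :: xs))) C →
      P.Run e δ (P.pair (Y P.tt [a] []) (P.code [a])) C := by
    intro xs
    induction xs using List.reverseRecOn with
    | nil => exact fun _ h => h
    | append_singleton xs x ih =>
      intro hxs hrun
      obtain ⟨hxs, q, ⟨c, hc, hcf, hcq⟩, hx⟩ := P.answers_concat.1 hxs
      refine ih hxs (Run.of_appVal (Y := Y P.tt (a :: xs)) (sask (a :: xs)) (fun k u hk => ?_)
        ((P.mem_bappFun hP).1 hc))
      obtain ⟨h0, hL, hM⟩ := ev P.tt (a :: xs) k u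
      obtain ⟨h1, h2⟩ := Ev.returns hrs hk hM
      refine .step (hE _ _ (Ev.cond_tt h0 (Ev.cond_tt h1 (Ev.cond_ff (h2.fst' hcf)
        ((Ev.const _ _).mkPair (((Ev.const _ _).mkPair (hL.mkPair (hn _))).mkPair
          (h2.snd' ⟨q, hcq, le_rfl⟩))))))) ?_
      refine Run.of_appVal (Y := Y P.ff (a :: xs)) (task (a :: xs)) (fun k u hk => ?_)
        ((P.mem_bappFun hP).1 hx)
      obtain ⟨h0, hL, hM⟩ := ev P.ff (a :: xs) k u
      obtain ⟨h1, h2⟩ := Ev.returns hrt hk hM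
      have hL' := Ev.snoc hSn hL h2
      exact .step (hE _ _ (Ev.cond_ff h0 (Ev.cond_tt h1 ((Ev.const _ _).mkPair
        (((Ev.const _ _).mkPair (hL'.mkPair (hn _))).mkPair hL'))))) hrun
  have ha := (Ev.env_zero (P := P) a ι).cons (hn _)
  refine H δ a _ C (hI _ _ (((Ev.const _ _).mkPair (ha.mkPair (hn _))).mkPair ha))
    (key xs hxs ?_)
  obtain ⟨c, hc, hct, hcC⟩ := hret
  refine Run.of_appVal (Y := Y P.tt (a :: xs)) (sask (a :: xs)) (fun k u hk => ?_)
    ((P.mem_bappFun hP).1 hc)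
  obtain ⟨h0, hL, hM⟩ := ev P.tt (a :: xs) k u
  obtain ⟨h1, h2⟩ := Ev.returns hrs hk hM
  exact .ret (hE _ _ (Ev.cond_tt h0 (Ev.cond_tt h1 (Ev.cond_tt (h2.fst' hct)
    ((Ev.const _ _).mkPair (((Ev.const _ _).mkPair (h2.snd' ⟨C, hcC, le_rfl⟩)).mkPair
      (hn _)))))))

/-! ### Joins of oracles and currying -/

/-- The answers of the join of two oracles: the first component of a question tells which of
the oracles to consult. -/
def JoinVal (P : PCA A) (γ γ' : BFun A) (q c : A) : Prop :=
  (P.Maps P.p₀ q P.tt ∧ ∃ q' ∈ P.app P.p₁ q, c ∈ γ.1 q') ∨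
    (P.Maps P.p₀ q P.ff ∧ ∃ q' ∈ P.app P.p₁ q, c ∈ γ'.1 q')

theorem not_maps_tt_ff (hP : ¬ P.Semitrivial) {f x : A} (ht : P.Maps f x P.tt)
    (hf : P.Maps f x P.ff) : False := by
  obtain ⟨m, hm, h⟩ := ht
  obtain ⟨m', hm', h'⟩ := hf
  obtain rfl := Part.mem_unique hm hm'
  exact hP ⟨m, h, h'⟩

/-- The two alternatives exclude each other because `A` is not semitrivial. -/
theorem JoinVal.unique (hP : ¬ P.Semitrivial) {γ γ' : BFun A} {q c d : A}
    (hc : P.JoinVal γ γ' q c) (hd : P.JoinVal γ γ' q d) : c = d := by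
  rcases hc with ⟨ht, x, hx, hc⟩ | ⟨ht, x, hx, hc⟩ <;>
    rcases hd with ⟨ht', y, hy, hd⟩ | ⟨ht', y, hy, hd⟩
  · obtain rfl := Part.mem_unique hx hy
    exact Part.mem_unique hc hd
  · exact (not_maps_tt_ff hP ht ht').elim
  · exact (not_maps_tt_ff hP ht' ht).elim
  · obtain rfl := Part.mem_unique hx hy
    exact Part.mem_unique hc hd

theorem JoinVal.mono {γ γ' : BFun A} {q q' c : A} (hq : q' ≤ q) (hc : P.JoinVal γ γ' q c) :
    ∃ c', P.JoinVal γ γ' q' c' ∧ c' ≤ c := by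
  rcases hc with ⟨ht, x, hx, hc⟩ | ⟨ht, x, hx, hc⟩ <;>
    obtain ⟨x', hx', hxx⟩ := P.app_mono _ _ _ _ le_rfl hq x hx
  · obtain ⟨c', hc', hcc⟩ := γ.2 _ _ hxx c hc
    exact ⟨c', .inl ⟨ht.mono le_rfl hq le_rfl, x', hx', hc'⟩, hcc⟩
  · obtain ⟨c', hc', hcc⟩ := γ'.2 _ _ hxx c hc
    exact ⟨c', .inr ⟨ht.mono le_rfl hq le_rfl, x', hx', hc'⟩, hcc⟩

theorem mem_joinPart (hP : ¬ P.Semitrivial) {γ γ' : BFun A} {q c : A} :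
    c ∈ (⟨∃ c, P.JoinVal γ γ' q c, fun h => h.choose⟩ : Part A) ↔ P.JoinVal γ γ' q c :=
  ⟨fun ⟨h, hc⟩ => hc ▸ h.choose_spec,
    fun h => ⟨⟨c, h⟩, JoinVal.unique hP (Exists.choose_spec ⟨c, h⟩) h⟩⟩

/-- The join of two oracles. -/
noncomputable def join (hP : ¬ P.Semitrivial) (γ γ' : BFun A) : BFun A :=
  ⟨fun q => ⟨∃ c, P.JoinVal γ γ' q c, fun h => h.choose⟩, fun _ _ h c hc => by
    obtain ⟨c', hc', hcc⟩ := JoinVal.mono h ((mem_joinPart hP).1 hc)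
    exact ⟨c', (mem_joinPart hP).2 hc', hcc⟩⟩

/-- Only an inequality is available, since unpairing recovers `q` only up to something smaller. -/
theorem mem_join_left (hP : ¬ P.Semitrivial) {γ γ' : BFun A} {q c : A} (h : c ∈ γ.1 q) :
    ∃ c' ∈ (join hP γ γ').1 (P.pair P.tt q), c' ≤ c := by
  obtain ⟨q', hq', hqq⟩ := P.maps_p₁ P.tt q
  obtain ⟨c', hc', hcc⟩ := γ.2 _ _ hqq c h
  exact ⟨c', (mem_joinPart hP).2 (.inl ⟨P.maps_p₀ _ _, q', hq', hc'⟩), hcc⟩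

theorem mem_join_right (hP : ¬ P.Semitrivial) {γ γ' : BFun A} {q c : A} (h : c ∈ γ'.1 q) :
    ∃ c' ∈ (join hP γ γ').1 (P.pair P.ff q), c' ≤ c := by
  obtain ⟨q', hq', hqq⟩ := P.maps_p₁ P.ff q
  obtain ⟨c', hc', hcc⟩ := γ'.2 _ _ hqq c h
  exact ⟨c', (mem_joinPart hP).2 (.inr ⟨P.maps_p₀ _ _, q', hq', hc'⟩), hcc⟩

/-- Currying: an effective operator on joins yields an effective operator of two arguments. -/
theorem exists_curry (hP : ¬ P.Semitrivial) {σ : BFun A} (hσ : P.EffRepresentable σ) :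
    ∃ ρ, P.EffRepresentable ρ ∧
      ∀ γ γ', P.bapp hP (P.bapp hP ρ γ) γ' ≤ P.bapp hP σ (join hP γ γ') := by
  obtain ⟨s, hs, hrs⟩ := hσ
  obtain ⟨sn, hsn, hSn⟩ := P.exists_snoc
  -- `R` holds the answers of `γ'` not yet used; `M` is the log of `σ` including the latest entry.
  let R : Term A := P.fst (P.fst (.var 0))
  let M : Term A := .app (.const sn) (P.mkPair (P.snd (P.fst (.var 0))) (P.snd (.var 0)))
  let m : Term A := .app (.const s) M
  let nil : Term A := .const (P.code [])
  -- The machine's result is itself a reply of the interrogator `ργ`: `(⊤, c)` when `σ` returns `c`,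
  -- and `(⊥, q)` when `σ` has a question `q` for `γ'` and `R` is empty. If `R` is not empty, its
  -- head serves as the answer.
  obtain ⟨e, he, hE⟩ := exists_rec (P := P)
    (t := P.cond (P.fst m)
      (P.mkPair (.const P.ff)
        (P.mkPair (P.mkPair (.const P.tt) (P.mkPair (.const P.tt) (P.snd m))) nil))
      (P.cond (P.fst (P.snd m))
        (P.mkPair (.const P.ff)
          (P.mkPair (P.mkPair (.const P.ff) (P.snd (P.snd m))) (P.mkPair R M)))
        (P.cond (P.isNil R)
          (P.mkPair (.const P.ff) (P.mkPair
            (P.mkPair (.const P.tt) (P.mkPair (.const P.ff) (P.snd (P.snd m)))) nil))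
          (P.mkPair (.const P.tt) (P.mkPair (P.mkPair (P.tl R) M) (P.hd R))))))
    (by simp [R, M, m, nil, hs, hsn])
  obtain ⟨ι, hι, hI⟩ := exists_rec (P := P)
    (t := P.mkPair (P.mkPair (P.tl (.var 0)) nil) (P.hd (.var 0))) (by simp [nil])
  obtain ⟨ρ, hρ, H⟩ := exists_interrogator he hι
  refine ⟨ρ, hρ, fun γ γ' => (bapp_le_iff hP).2 fun a c hc => ?_⟩
  obtain ⟨ws, hws, hret⟩ := (P.mem_bappFun hP).1 hc
  let Z : List A → List A → A → A := fun k l u => P.pair (P.pair (P.code l) (P.code k)) u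
  have hn : ∀ ρ, P.Ev ρ nil (P.code []) := fun ρ => Ev.const ρ _
  have ev : ∀ k l u, P.Ev (P.env (Z k l u) e) R (P.code l) ∧
      P.Ev (P.env (Z k l u) e) M (P.code (k ++ [u])) := fun k l u => by
    have h0 := Ev.env_zero (P := P) (Z k l u) e
    exact ⟨h0.fst.fst, Ev.snoc hSn h0.fst.snd h0.snd⟩
  have init : ∀ us C, P.Run e γ (Z [] us a) C →
      ∃ C', P.AppVal ρ γ (P.code (a :: us)) C' ∧ C' ≤ C := fun us C hrun => by
    have h0 := Ev.env_zero (P := P) (P.code (a :: us)) ι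
    exact H γ _ _ C (hI _ _ ((h0.tl.mkPair (hn _)).mkPair h0.hd)) hrun
  have split : ∀ us : List A, ∃ k u, k ++ [u] = a :: us := fun us =>
    ⟨_, _, List.dropLast_append_getLast (List.cons_ne_nil a us)⟩
  -- From the answers `ws` of the join, the answers `us` of `γ'` are extracted, together with a way
  -- to extend any run from the state after `ws`, with `l` left in `R`, to a run from the start with
  -- `us ++ l`.
  have key : ∀ ws, P.Answers σ (join hP γ γ') a ws →
      ∃ us, P.Answers (P.bapp hP ρ γ) γ' a us ∧ ∀ k u, k ++ [u] = a :: ws →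
        ∀ l C, P.Run e γ (Z k l u) C → P.Run e γ (Z [] (us ++ l) a) C := by
    intro ws
    induction ws using List.reverseRecOn with
    | nil =>
      refine fun _ => ⟨[], answers_nil, fun k u hk l C hrun => ?_⟩
      obtain ⟨rfl, h⟩ := List.append_inj' (hk.trans (List.nil_append [a]).symm) rfl
      obtain rfl := List.singleton_injective h
      exact hrun
    | append_singleton ws x ih =>
      intro hws
      obtain ⟨hws', Q, hQ, hx⟩ := P.answers_concat.1 hws
      obtain ⟨us, hus, hrec⟩ := ih hws'
      obtain ⟨k₀, u₀, hk₀⟩ := split ws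
      rw [← hk₀] at hQ
      rcases (mem_joinPart hP).1 hx with ⟨hQ₀, q, hq, hx⟩ | ⟨hQ₀, q, hq, hx⟩
      · refine ⟨us, hus, fun k u hk l C hrun => hrec k₀ u₀ hk₀ l C ?_⟩
        obtain ⟨rfl, h⟩ := List.append_inj' (hk.trans (List.cons_append (bs := [x])).symm) rfl
        obtain rfl := List.singleton_injective h
        obtain ⟨hR, hM⟩ := ev k₀ l u₀
        obtain ⟨h1, h2⟩ := Ev.asks hrs hQ hM
        rw [← hk₀] at hrun
        exact .ask (hE _ _ (Ev.cond_ff h1 (Ev.cond_tt (h2.fst' hQ₀) ((Ev.const _ _).mkPair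
          (((Ev.const _ _).mkPair (h2.snd' ⟨q, hq, le_rfl⟩)).mkPair (hR.mkPair hM)))))) hx hrun
      -- Running with nothing left in `R` stops exactly at this question, which shows that `ργ` asks
      -- it after `us`. The answer then becomes available to longer replays.
      · have hr1 : P.Run e γ (Z k₀ [] u₀) (P.pair P.ff q) := by
          obtain ⟨hR, hM⟩ := ev k₀ [] u₀
          obtain ⟨h1, h2⟩ := Ev.asks hrs hQ hM
          exact .ret (hE _ _ (Ev.cond_ff h1 (Ev.cond_ff (h2.fst' hQ₀) (Ev.cond_tt hR.isNil_nil
            ((Ev.const _ _).mkPair (((Ev.const _ _).mkPair ((Ev.const _ _).mkPair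
              (h2.snd' ⟨q, hq, le_rfl⟩))).mkPair (hn _)))))))
        have hr2 := hrec k₀ u₀ hk₀ [] _ hr1
        rw [List.append_nil] at hr2
        obtain ⟨m, hm, hmq⟩ := init us _ hr2
        obtain ⟨b, hb, hbf⟩ := (P.maps_p₀ P.ff q).mono le_rfl hmq le_rfl
        obtain ⟨q', hq', hqq⟩ := (P.maps_p₁ P.ff q).mono le_rfl hmq le_rfl
        obtain ⟨x', hx', hxx⟩ := γ'.2 _ _ hqq x hx
        refine ⟨us ++ [x'], P.answers_concat.2 ⟨hus, q', ⟨m, (P.mem_bappFun hP).2 hm,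
          ⟨b, hb, hbf⟩, hq'⟩, hx'⟩, fun k u hk l C hrun => ?_⟩
        rw [List.append_assoc]
        refine hrec k₀ u₀ hk₀ (x' :: l) C ?_
        obtain ⟨rfl, h⟩ := List.append_inj' (hk.trans (List.cons_append (bs := [x])).symm) rfl
        obtain rfl := List.singleton_injective h
        obtain ⟨hR, hM⟩ := ev k₀ (x' :: l) u₀
        obtain ⟨h1, h2⟩ := Ev.asks hrs hQ hM
        rw [← hk₀] at hrun
        exact .step (hE _ _ (Ev.cond_ff h1 (Ev.cond_ff (h2.fst' hQ₀) (Ev.cond_ff hR.isNil_cons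
          ((Ev.const _ _).mkPair ((hR.tl.mkPair hM).mkPair hR.hd))))))
          (hrun.mono (P.pair_mono le_rfl hxx))
  obtain ⟨us, hus, hrec⟩ := key ws hws
  obtain ⟨k, u, hk⟩ := split ws
  have hr1 : P.Run e γ (Z k [] u) (P.pair P.tt c) := by
    obtain ⟨hR, hM⟩ := ev k [] u
    rw [← hk] at hret
    obtain ⟨h1, h2⟩ := Ev.returns hrs hret hM
    exact .ret (hE _ _ (Ev.cond_tt h1 ((Ev.const _ _).mkPair (((Ev.const _ _).mkPair
      ((Ev.const _ _).mkPair h2)).mkPair (hn _)))))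
  have hr2 := hrec k u hk [] _ hr1
  rw [List.append_nil] at hr2
  obtain ⟨m, hm, hmq⟩ := init us _ hr2
  obtain ⟨b, hb, hbf⟩ := (P.maps_p₀ P.tt c).mono le_rfl hmq le_rfl
  obtain ⟨c', hc', hcc⟩ := (P.maps_p₁ P.tt c).mono le_rfl hmq le_rfl
  exact ⟨c', ⟨us, hus, m, (P.mem_bappFun hP).2 hm, ⟨b, hb, hbf⟩, hc'⟩, hcc⟩

/-! ### Query operators and the combinators of `𝓑A`. -/

/-- For effective `q`, `q'`, `f`, the operator that puts the questions `qx` and `q'x` to the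
oracle and applies `f` to the input and the answers is effective. -/
theorem exists_two_queries {q q' f : A} (hq : q ∈ P.sharp) (hq' : q' ∈ P.sharp)
    (hf : f ∈ P.sharp) : ∃ ρ, P.EffRepresentable ρ ∧ ∀ (δ : BFun A) (x y y' u u' c : A),
      P.Maps q x y → u ∈ δ.1 y → P.Maps q' x y' → u' ∈ δ.1 y' →
      P.Maps f (P.pair x (P.pair u u')) c → ∃ c', P.AppVal ρ δ x c' ∧ c' ≤ c := by
  let y : Term A := P.fst (.var 0)
  let u : Term A := P.snd (.var 0)
  let tt : Term A := .const P.tt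
  let ff : Term A := .const P.ff
  -- The memory passes through `(⊤, x)`, `(⊥, (⊤, x))` and `(⊥, (⊥, (x, u)))`, its flags telling how
  -- many questions have been answered.
  obtain ⟨e, he, hE⟩ := exists_rec (P := P)
    (t := P.mkPair ff (P.cond (P.fst y)
      (P.mkPair (P.mkPair ff (.app (.const q) (P.snd y)))
        (P.mkPair ff (P.mkPair tt (P.snd y))))
      (P.cond (P.fst (P.snd y))
        (P.mkPair (P.mkPair ff (.app (.const q') (P.snd (P.snd y))))
          (P.mkPair ff (P.mkPair ff (P.mkPair (P.snd (P.snd y)) u))))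
        (P.mkPair (P.mkPair tt (.app (.const f) (P.mkPair (P.fst (P.snd (P.snd y)))
          (P.mkPair (P.snd (P.snd (P.snd y))) u)))) tt))))
    (by simp [y, u, tt, ff, hq, hq', hf])
  -- The second `⊤` is a dummy in the place of the latest answer.
  obtain ⟨ι, hι, hI⟩ := exists_rec (P := P)
    (t := P.mkPair (P.mkPair tt (.var 0)) tt) (by simp [tt])
  obtain ⟨ρ, hρ, H⟩ := exists_interrogator he hι
  have htt : ∀ ρ, P.Ev ρ tt P.tt := fun ρ => Ev.const ρ _
  have hff : ∀ ρ, P.Ev ρ ff P.ff := fun ρ => Ev.const ρ _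
  refine ⟨ρ, hρ, fun δ x y y' u u' c hy hu hy' hu' hc =>
    H δ x _ c (hI _ _ (((htt _).mkPair (Ev.env_zero _ _)).mkPair (htt _))) ?_⟩
  refine .ask (y := P.pair P.ff (P.pair P.tt x)) (hE _ _ ?_) hu
    (.ask (y := P.pair P.ff (P.pair P.ff (P.pair x u))) (hE _ _ ?_) hu'
      (.ret (z := P.tt) (hE _ _ ?_)))
  · have h0 := Ev.env_zero (P := P) (P.pair (P.pair P.tt x) P.tt) e
    exact (hff _).mkPair (Ev.cond_tt h0.fst.fst
      (((hff _).mkPair ((Ev.const _ _).app h0.fst.snd hy)).mkPair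
        ((hff _).mkPair ((htt _).mkPair h0.fst.snd))))
  · have h0 := Ev.env_zero (P := P) (P.pair (P.pair P.ff (P.pair P.tt x)) u) e
    exact (hff _).mkPair (Ev.cond_ff h0.fst.fst (Ev.cond_tt h0.fst.snd.fst
      (((hff _).mkPair ((Ev.const _ _).app h0.fst.snd.snd hy')).mkPair
        ((hff _).mkPair ((hff _).mkPair (h0.fst.snd.snd.mkPair h0.snd))))))
  · have h0 := Ev.env_zero (P := P)
      (P.pair (P.pair P.ff (P.pair P.ff (P.pair x u))) u') e
    exact (hff _).mkPair (Ev.cond_ff h0.fst.fst (Ev.cond_ff h0.fst.snd.fst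
      (((htt _).mkPair ((Ev.const _ _).app
        (h0.fst.snd.snd.fst.mkPair (h0.fst.snd.snd.snd.mkPair h0.snd)) hc)).mkPair (htt _))))

/-- Reindexing of an oracle along an effective function is effective. -/
theorem exists_reindex (hP : ¬ P.Semitrivial) {t : Term A} (ht : t.ConstsIn P.sharp) :
    ∃ ρ, P.EffRepresentable ρ ∧ ∀ δ φ : BFun A,
      (∀ x, ∀ c ∈ φ.1 x, ∃ y, (∀ v, P.Ev (P.env x v) t y) ∧ ∃ c' ∈ δ.1 y, c' ≤ c) →
      P.bapp hP ρ δ ≤ φ := by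
  obtain ⟨q, hq, hQ⟩ := exists_rec ht
  obtain ⟨f, hf, hF⟩ := exists_rec (P := P) (t := P.snd (P.snd (.var 0))) (by simp)
  -- One question is enough here; it is asked twice and `f` keeps the second answer.
  obtain ⟨ρ, hρ, H⟩ := exists_two_queries hq hq hf
  refine ⟨ρ, hρ, fun δ φ h => (bapp_le_iff hP).2 fun x c hc => ?_⟩
  obtain ⟨y, hy, c', hc', hcc⟩ := h x c hc
  obtain ⟨d, hd, hdc⟩ := H δ x y y c' c' c' (hQ _ _ (hy _)) hc' (hQ _ _ (hy _)) hc'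
    (hF _ _ (Ev.env_zero _ _).snd.snd)
  exact ⟨d, hd, hdc.trans hcc⟩

theorem exists_id (hP : ¬ P.Semitrivial) :
    ∃ ρ, P.EffRepresentable ρ ∧ ∀ α, P.bapp hP ρ α ≤ α := by
  obtain ⟨ρ, hρ, H⟩ := exists_reindex hP (P := P) (t := .var 0) (by simp)
  exact ⟨ρ, hρ, fun α => H α α fun x c hc => ⟨x, fun v => Ev.env_zero _ _, c, hc, le_rfl⟩⟩

theorem exists_k (hP : ¬ P.Semitrivial) :
    ∃ κ, P.EffRepresentable κ ∧ ∀ α β, P.bapp hP (P.bapp hP κ α) β ≤ α := by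
  obtain ⟨σ, hσ, H⟩ := exists_reindex hP (P := P) (t := P.mkPair (.const P.tt) (.var 0))
    (by simp)
  obtain ⟨κ, hκ, hK⟩ := exists_curry hP hσ
  exact ⟨κ, hκ, fun α β => (hK α β).trans (H _ _ fun x c hc =>
    ⟨_, fun v => (Ev.const _ _).mkPair (Ev.env_zero _ _), mem_join_left hP hc⟩)⟩

/-- On the oracle `(α ∨ β) ∨ γ`, the reindexings `π₀`, `π₁`, `π₂` recover `α`, `β`, `γ` up to `≤`.
The operator `δ ↦ ((π₀δ)(π₂δ))((π₁δ)(π₂δ))` is then curried twice. -/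
theorem exists_s (hP : ¬ P.Semitrivial) :
    ∃ σ, P.EffRepresentable σ ∧ ∀ α β γ, P.bapp hP (P.bapp hP (P.bapp hP σ α) β) γ ≤
      P.bapp hP (P.bapp hP α γ) (P.bapp hP β γ) := by
  obtain ⟨π₀, h₀, H₀⟩ := exists_reindex hP (P := P)
    (t := P.mkPair (.const P.tt) (P.mkPair (.const P.tt) (.var 0))) (by simp)
  obtain ⟨π₁, h₁, H₁⟩ := exists_reindex hP (P := P)
    (t := P.mkPair (.const P.tt) (P.mkPair (.const P.ff) (.var 0))) (by simp)
  obtain ⟨π₂, h₂, H₂⟩ := exists_reindex hP (P := P)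
    (t := P.mkPair (.const P.ff) (.var 0)) (by simp)
  obtain ⟨σ₀, hσ₀, L₀⟩ := exists_bapp_bapp hP h₀ h₂
  obtain ⟨σ₁, hσ₁, L₁⟩ := exists_bapp_bapp hP h₁ h₂
  obtain ⟨σ₂, hσ₂, L₂⟩ := exists_bapp_bapp hP hσ₀ hσ₁
  obtain ⟨σ₃, hσ₃, C₃⟩ := exists_curry hP hσ₂
  obtain ⟨σ, hσ, C⟩ := exists_curry hP hσ₃
  refine ⟨σ, hσ, fun α β γ => (bapp_mono hP (C α β) le_rfl).trans
    ((C₃ _ γ).trans ((L₂ _).trans ?_))⟩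
  have e₀ : P.bapp hP π₀ (join hP (join hP α β) γ) ≤ α := H₀ _ _ fun x c hc => by
    obtain ⟨c₁, hc₁, h₁⟩ := mem_join_left hP (γ' := β) hc
    obtain ⟨c₂, hc₂, h₂⟩ := mem_join_left hP (γ' := γ) hc₁
    exact ⟨_, fun v => (Ev.const _ _).mkPair ((Ev.const _ _).mkPair (Ev.env_zero _ _)),
      c₂, hc₂, h₂.trans h₁⟩
  have e₁ : P.bapp hP π₁ (join hP (join hP α β) γ) ≤ β := H₁ _ _ fun x c hc => by
    obtain ⟨c₁, hc₁, h₁⟩ := mem_join_right hP (γ := α) hc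
    obtain ⟨c₂, hc₂, h₂⟩ := mem_join_left hP (γ' := γ) hc₁
    exact ⟨_, fun v => (Ev.const _ _).mkPair ((Ev.const _ _).mkPair (Ev.env_zero _ _)),
      c₂, hc₂, h₂.trans h₁⟩
  have e₂ : P.bapp hP π₂ (join hP (join hP α β) γ) ≤ γ := H₂ _ _ fun x c hc =>
    ⟨_, fun v => (Ev.const _ _).mkPair (Ev.env_zero _ _), mem_join_right hP hc⟩
  exact bapp_mono hP ((L₀ _).trans (bapp_mono hP e₀ e₂)) ((L₁ _).trans (bapp_mono hP e₁ e₂))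

theorem B_isPCA (hP : ¬ P.Semitrivial) : (P.B hP).IsPCA := by
  obtain ⟨κ, hκ, hK⟩ := exists_k hP
  obtain ⟨σ, hσ, hS⟩ := exists_s hP
  refine ⟨⟨⟨κ, hκ⟩, ?_, ?_⟩, κ, hκ, σ, hσ, ?_, ?_, ?_⟩
  · rintro α hα β hβ _ hc
    obtain rfl := Part.mem_some_iff.1 hc
    exact EffRepresentable.bapp hP hα hβ
  · rintro α β h ⟨r, hr, hrα⟩
    exact ⟨r, hr, fun a => (hrα a).trans (h a)⟩
  · exact fun α β => ⟨_, mem_ap_some.2 ⟨_, Part.mem_some _, Part.mem_some _⟩, hK α β⟩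
  · exact fun α β => Part.dom_iff_mem.2
      ⟨_, mem_ap_some.2 ⟨_, Part.mem_some _, Part.mem_some _⟩⟩
  · intro α β γ c hc
    obtain rfl : c = P.bapp hP (P.bapp hP α γ) (P.bapp hP β γ) := by
      simpa [PAP.ap, B] using hc
    exact ⟨_, mem_ap_some.2 ⟨_, mem_ap_some.2 ⟨_, Part.mem_some _, Part.mem_some _⟩,
      Part.mem_some _⟩, hS α β γ⟩

/-! ### The morphism of constant functions. -/

/-- Application in `𝓑A` is total and monotone, so principal downsets multiply as their generators
do. The conditions on the morphism thus become inequalities in `𝓑A`. -/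
theorem dapp_Iic (hP : ¬ P.Semitrivial) (α β : BFun A) :
    (P.B hP).dapp (LowerSet.Iic α) (LowerSet.Iic β) =
      Part.some (LowerSet.Iic (P.bapp hP α β)) := by
  refine Part.eq_some_iff.2 ⟨fun _ _ _ _ => trivial, le_antisymm ?_ ?_⟩
  · refine lowerClosure_le.2 ?_
    rintro _ ⟨α', hα, β', hβ, hc⟩
    obtain rfl := Part.mem_some_iff.1 hc
    exact bapp_mono hP hα hβ
  · exact LowerSet.Iic_le.2 (subset_lowerClosure
      ⟨α, le_refl α, β, le_refl β, Part.mem_some _⟩)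

theorem const_effRepresentable {a : A} (ha : a ∈ P.sharp) :
    P.EffRepresentable (BFun.const a) := by
  obtain ⟨f, hf⟩ := Part.dom_iff_mem.1 (P.ka_dom a)
  refine ⟨f, app_mem P.k_mem ha hf, fun x c hc => ?_⟩
  obtain rfl := Part.mem_some_iff.1 hc
  obtain ⟨d, hd, hda⟩ := P.comb.k_le c x
  obtain ⟨f', hf', hd⟩ := mem_ap_some.1 hd
  obtain rfl := Part.mem_unique hf hf'
  exact ⟨d, hd, hda⟩

theorem const_isPartialApplicativeMorphism (hP : ¬ P.Semitrivial) :
    IsPartialApplicativeMorphism P.toRelPAP (P.B hP)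
      (fun a : A => LowerSet.Iic (BFun.const a)) where
  sharp a ha := ⟨BFun.const a, le_refl (BFun.const a), const_effRepresentable ha⟩
  tracker := by
    obtain ⟨q, hq, hQ⟩ := exists_rec (P := P) (t := P.mkPair (.const P.tt) (.var 0)) (by simp)
    obtain ⟨q', hq', hQ'⟩ := exists_rec (P := P) (t := P.mkPair (.const P.ff) (.var 0))
      (by simp)
    -- The queries `(⊤, x)` and `(⊥, x)` to the join of `â` and `â'` yield values below `a` and
    -- `a'`; `f` applies the first to the second. Currying turns this into a tracker.
    obtain ⟨f, hf, hF⟩ := exists_rec (P := P)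
      (t := .app (P.fst (P.snd (.var 0))) (P.snd (P.snd (.var 0)))) (by simp)
    obtain ⟨σ, hσ, H⟩ := exists_two_queries hq hq' hf
    obtain ⟨t, ht, hT⟩ := exists_curry hP hσ
    refine ⟨t, ht, fun a a' c hc => ?_⟩
    simp only [dapp_Iic, Part.bind_some]
    refine ⟨_, Part.mem_some _, LowerSet.Iic_le.2 ((hT _ _).trans
      ((bapp_le_iff hP).2 fun x d hd => ?_))⟩
    obtain rfl := Part.mem_some_iff.1 hd
    obtain ⟨b, hb, hba⟩ := mem_join_left hP (γ := BFun.const a) (γ' := BFun.const a') (q := x)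
      (Part.mem_some a)
    obtain ⟨b', hb', hba'⟩ := mem_join_right hP (γ := BFun.const a) (γ' := BFun.const a')
      (q := x) (Part.mem_some a')
    have h0 := Ev.env_zero (P := P) (P.pair x (P.pair b b')) f
    exact H _ x _ _ b b' d (hQ _ _ ((Ev.const _ _).mkPair (Ev.env_zero _ _))) hb
      (hQ' _ _ ((Ev.const _ _).mkPair (Ev.env_zero _ _))) hb'
      (hF _ _ (h0.snd.fst.app h0.snd.snd (Maps.mono ⟨d, hc, le_rfl⟩ hba hba' le_rfl)))
  order := by
    obtain ⟨u, hu, hU⟩ := exists_id hP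
    refine ⟨u, hu, fun a => ?_⟩
    rw [dapp_Iic]
    refine ⟨trivial, fun a' h δ hδ => ?_⟩
    obtain rfl := Part.mem_some_iff.1 hδ
    refine LowerSet.Iic_le.2 ((hU _).trans fun x c hc => ?_)
    obtain rfl := Part.mem_some_iff.1 hc
    exact ⟨a, Part.mem_some _, h⟩

/-- Given `r` representing `s`, the oracle with constant value `r` is queried at `x` itself, and the
answer is applied to `x`. The operator is a universal evaluator, independent of `s`. -/
theorem const_isComputationallyDense (hP : ¬ P.Semitrivial) :
    IsComputationallyDense P.toRelPAP (P.B hP)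
      (fun a : A => LowerSet.Iic (BFun.const a)) := by
  obtain ⟨f, hf, hF⟩ := exists_rec (P := P)
    (t := .app (P.fst (P.snd (.var 0))) (P.fst (.var 0))) (by simp)
  obtain ⟨n, hn, H⟩ := exists_two_queries P.i_mem P.i_mem hf
  refine ⟨n, hn, ?_⟩
  rintro s ⟨r, hr, hrs⟩
  refine ⟨r, hr, ?_⟩
  rw [dapp_Iic]
  refine ⟨_, Part.mem_some _, LowerSet.Iic_le.2 ((bapp_le_iff hP).2 fun x c hc => ?_)⟩
  have h0 := Ev.env_zero (P := P) (P.pair x (P.pair r r)) f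
  exact H _ x x x r r c (P.maps_i x) (Part.mem_some _) (P.maps_i x) (Part.mem_some _)
    (hF _ _ (h0.snd.fst.app h0.fst (Maps.of_represents hrs hc)))

end PCA

end ROPCA

theorem mainTheorem11 {A : Type*} [PartialOrder A] (P : ROPCA.PCA A) (hP : ¬ P.Semitrivial) :
    (P.B hP).IsPCA ∧
    ROPCA.IsPartialApplicativeMorphism P.toRelPAP (P.B hP)
      (fun a : A => LowerSet.Iic (ROPCA.BFun.const a)) ∧
    ROPCA.IsTotal (fun a : A => LowerSet.Iic (ROPCA.BFun.const a)) ∧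
    ROPCA.IsComputationallyDense P.toRelPAP (P.B hP)
      (fun a : A => LowerSet.Iic (ROPCA.BFun.const a)) :=
  ⟨ROPCA.PCA.B_isPCA hP, ROPCA.PCA.const_isPartialApplicativeMorphism hP,
    fun a => ⟨ROPCA.BFun.const a, le_refl (ROPCA.BFun.const a)⟩,
    ROPCA.PCA.const_isComputationallyDense hP⟩
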